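/- A graph $G$ on $n$ vertices is weakly $F$-saturated if it contains no (not necessarily induced) copy of $F$ and there is an ordering $e_1,\dots,e_m$ of the edges of $E(K_n)\setminus E(G)$ such that, for each $i\in\{1,\dots,m\}$, the graph $G\cup\{e_1,\dots,e_i\}$ contains a copy $F_i$ of $F$ with $e_i\in E(F_i)$. Let $\mathrm{wsat}(n,F)$ denote the minimum number of edges in a weakly $F$-saturated graph on $n$ vertices, and let $K_{s,t}$ be the complete bipartite graph with parts of sizes $s$ and $t$. Theorem. Let $s,t$ be integers with $t>s>2$. If $\gcd(s,t)=1$, then $$\mathrm{wsat}(s+t+1,K_{s,t})=\binom{s+t+1}{2}-(2s+2t-2).$$ If $\gcd(s,t)\neq 1$, then $$2s+2t-3\;\le\;\binom{s+t+1}{2}-\mathrm{wsat}(s+t+1,K_{s,t})\;\le\;2s+2t-2.$$ -/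

import Mathlib

/-- `G` is weakly `F`-saturated: `G` contains no copy of `F`, and the edges of the complete graph
that are missing from `G` can be ordered as `e 0, …, e (m - 1)` so that, for every `i`, the graph
`G ∪ {e 0, …, e i}` contains a (not necessarily induced) copy of `F` using the edge `e i`. -/
def IsWeaklySaturated {V W : Type*} (F : SimpleGraph W) (G : SimpleGraph V) : Prop :=
  F.Free G ∧
    ∃ (m : ℕ) (e : Fin m → Sym2 V),
      Set.BijOn e Set.univ ((⊤ : SimpleGraph V).edgeSet \ G.edgeSet) ∧
      ∀ i : Fin m, ∃ f : SimpleGraph.Copy F (G ⊔ SimpleGraph.fromEdgeSet (e '' Set.Iic i)),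
        e i ∈ f.toSubgraph.edgeSet

/-- The weak saturation number: the minimum number of edges of a weakly `F`-saturated graph on
`n` vertices. -/
noncomputable def wsat {W : Type*} (n : ℕ) (F : SimpleGraph W) : ℕ :=
  sInf {k : ℕ | ∃ G : SimpleGraph (Fin n), IsWeaklySaturated F G ∧ G.edgeSet.ncard = k}

/-! Work in the complement. A copy of `K_{s,t}` on `n = s + t + 1` vertices misses one vertex `v`,
and its two parts are the sides of a hinge cut of the complement. Read backwards, a saturating order
therefore builds the complement `H` of `G` from the empty graph, each new edge crossing a hinge cut
of the graph built so far. A graph built in this way that has no hinge cut left is the complement of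
a weakly saturated graph. The task is to find how many edges `k` such an `H` can have.

Upper bound: the two sides share only `v`, so adding one edge across a cut preserves the Laman count
of at most `2|W| - 3` edges in every set `W` with at least two vertices. This gives `k ≤ 2n - 3`,
one more than wanted. If equality held, the whole vertex set would be tight. Undoing the last edge
splits a tight set at the hinge into two tight sets, and a tight set untouched by that edge lies on
one side. Peeling edges off thus leaves a tight core with tight petals of size `s + 1`;
`not_core_with_petals`, helped by `not_star` and `not_detached_block`, shows that this pattern can
never shrink to the empty graph. Hence `k ≤ 2n - 4 = 2s + 2t - 2`.

Lower bound: split the vertices into `D` of size `s`, `Z` of size `t` and an apex. Edges inside `D`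
and at the apex number `2s + t - 2`, and one last edge joins `D` to `Z`. In between, with the apex
as hinge, edges are added inside `Z` across sets of size `s`. When `gcd(s, t) = 1`, arcs of length
`s` on a cycle of length `t` give `t - 1` of them; otherwise `t ≥ s + 2`, and `t - 2` can be
obtained by hand. -/

/-! ### Hinge cuts and erodible graphs -/

/-- `A`, `B` and the hinge `v` partition the vertices, with `A`, `B` of sizes `s`, `t`, and no edge
of `H` joins `A` to `B`. -/
structure IsHingeCut {V : Type*} (H : SimpleGraph V) (s t : ℕ) (v : V) (A B : Finset V) :
    Prop where
  card_left : A.card = s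
  card_right : B.card = t
  disj : ∀ u ∈ A, u ∉ B
  notMem_left : v ∉ A
  notMem_right : v ∉ B
  cover : ∀ u, u = v ∨ u ∈ A ∨ u ∈ B
  not_adj : ∀ a ∈ A, ∀ b ∈ B, ¬ H.Adj a b

/-- `H` arises from the empty graph by adding `k` edges, each across a hinge cut of the graph built
so far. -/
inductive Erodible {V : Type*} (s t : ℕ) : ℕ → SimpleGraph V → Prop
  | bot : Erodible s t 0 ⊥
  | step {k : ℕ} {H : SimpleGraph V} {v : V} {A B : Finset V} {x y : V} (h : Erodible s t k H)
      (hc : IsHingeCut H s t v A B) (hx : x ∈ A) (hy : y ∈ B) :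
      Erodible s t (k + 1) (H ⊔ SimpleGraph.edge x y)

theorem IsHingeCut.ne {V : Type*} {H : SimpleGraph V} {s t : ℕ} {v : V} {A B : Finset V}
    (hc : IsHingeCut H s t v A B) {x y : V} (hx : x ∈ A) (hy : y ∈ B) : x ≠ y := by
  rintro rfl
  exact hc.disj _ hx hy

theorem IsHingeCut.mono {V : Type*} {H K : SimpleGraph V} {s t : ℕ} {v : V} {A B : Finset V}
    (hc : IsHingeCut K s t v A B) (h : H ≤ K) : IsHingeCut H s t v A B :=
  ⟨hc.1, hc.2, hc.3, hc.4, hc.5, hc.6, fun a ha b hb hab => hc.7 a ha b hb (h hab)⟩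

theorem IsHingeCut.edgeSet_sup {V : Type*} {H : SimpleGraph V} {s t : ℕ} {v : V} {A B : Finset V}
    (hc : IsHingeCut H s t v A B) {x y : V} (hx : x ∈ A) (hy : y ∈ B) :
    (H ⊔ SimpleGraph.edge x y).edgeSet = insert s(x, y) H.edgeSet := by
  rw [SimpleGraph.edgeSet_sup, SimpleGraph.edgeSet_edge_of_ne (hc.ne hx hy), Set.union_singleton]

theorem Erodible.ncard_edgeSet {V : Type*} [Finite V] {s t k : ℕ} {H : SimpleGraph V}
    (h : Erodible s t k H) : H.edgeSet.ncard = k := by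
  induction h with
  | bot => simp
  | step h hc hx hy ih =>
    rw [hc.edgeSet_sup hx hy, Set.ncard_insert_of_notMem _ (Set.toFinite _), ih]
    exact hc.not_adj _ hx _ hy

/-! ### Edge counts, the sparsity bound and tight sets -/

open Classical in
/-- The number of edges of `H` inside `W`. -/
noncomputable def edgesIn {V : Type*} (H : SimpleGraph V) (W : Finset V) : ℕ :=
  (W.sym2.filter (· ∈ H.edgeSet)).card

theorem edgesIn_univ {V : Type*} [Fintype V] (H : SimpleGraph V) :
    edgesIn H Finset.univ = H.edgeSet.ncard := by
  classical
  rw [edgesIn, ← Set.ncard_coe_finset]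
  congr 1
  ext q
  simp

theorem edgesIn_of_card_le_one {V : Type*} (H : SimpleGraph V) {W : Finset V}
    (hW : W.card ≤ 1) : edgesIn H W = 0 := by
  classical
  rw [edgesIn, Finset.card_eq_zero, Finset.filter_eq_empty_iff]
  intro q hq
  induction q with
  | _ a b =>
    rw [Finset.mk_mem_sym2_iff] at hq
    intro h
    exact (H.ne_of_adj h) (Finset.card_le_one.1 hW a hq.1 b hq.2)

theorem edgesIn_sup_edge_le {V : Type*} {H : SimpleGraph V} {s t : ℕ} {v : V} {A B : Finset V}
    (hc : IsHingeCut H s t v A B) {x y : V} (hx : x ∈ A) (hy : y ∈ B) (W : Finset V) :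
    edgesIn (H ⊔ SimpleGraph.edge x y) W ≤ edgesIn H W + 1 := by
  classical
  have hE := hc.edgeSet_sup hx hy
  unfold edgesIn
  refine (Finset.card_le_card (t := insert s(x, y) (W.sym2.filter (· ∈ H.edgeSet))) ?_).trans
    (Finset.card_insert_le _ _)
  intro q hq
  simp only [Finset.mem_filter, Finset.mem_insert, hE, Set.mem_insert_iff] at hq ⊢
  tauto

theorem edgesIn_sup_edge_of_notMem {V : Type*} {H : SimpleGraph V} {s t : ℕ} {v : V}
    {A B : Finset V} (hc : IsHingeCut H s t v A B) {x y : V} (hx : x ∈ A) (hy : y ∈ B)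
    {W : Finset V} (hW : ¬ (x ∈ W ∧ y ∈ W)) :
    edgesIn (H ⊔ SimpleGraph.edge x y) W = edgesIn H W := by
  classical
  have hE := hc.edgeSet_sup hx hy
  unfold edgesIn
  congr 1
  ext q
  simp only [Finset.mem_filter, hE, Set.mem_insert_iff]
  constructor
  · rintro ⟨h1, rfl | h2⟩
    · exact absurd (Finset.mk_mem_sym2_iff.1 h1) hW
    · exact ⟨h1, h2⟩
  · tauto

section
variable {V : Type*} {H : SimpleGraph V} {s t k : ℕ} {v : V} {A B : Finset V}

theorem IsHingeCut.symm (hc : IsHingeCut H s t v A B) : IsHingeCut H t s v B A :=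
  ⟨hc.2, hc.1, fun u h1 h2 => hc.3 u h2 h1, hc.5, hc.4, fun u => by have := hc.6 u; tauto,
    fun b hb a ha h => hc.7 a ha b hb h.symm⟩

/-- `W` attains the sparsity bound. -/
def IsTight (H : SimpleGraph V) (W : Finset V) : Prop :=
  2 ≤ W.card ∧ edgesIn H W + 3 = 2 * W.card

theorem IsTight.of_sup_edge (hc : IsHingeCut H s t v A B) {x y : V} (hx : x ∈ A) (hy : y ∈ B)
    {W : Finset V} (hW : IsTight (H ⊔ SimpleGraph.edge x y) W) (hxy : ¬ (x ∈ W ∧ y ∈ W)) :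
    IsTight H W := by
  rwa [IsTight, edgesIn_sup_edge_of_notMem hc hx hy hxy] at hW

variable [DecidableEq V]

theorem IsHingeCut.edgesIn_le (hc : IsHingeCut H s t v A B) (W : Finset V) :
    edgesIn H W ≤ edgesIn H (W ∩ insert v A) + edgesIn H (W ∩ insert v B) := by
  classical
  rw [edgesIn, edgesIn, edgesIn]
  refine (Finset.card_le_card ?_).trans (Finset.card_union_le _ _)
  intro q hq
  induction q with
  | _ a b =>
    simp only [Finset.mem_filter, Finset.mem_union, Finset.mk_mem_sym2_iff, Finset.mem_inter,
      Finset.mem_insert, SimpleGraph.mem_edgeSet] at hq ⊢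
    have h1 := hc.cover a
    have h2 := hc.cover b
    have h3 := fun h h' => hc.not_adj a h b h' hq.2
    have h4 := fun h h' => hc.not_adj b h a h' hq.2.symm
    tauto

theorem IsHingeCut.card_inter (hc : IsHingeCut H s t v A B) (W : Finset V) :
    (W ∩ insert v A).card + (W ∩ insert v B).card = W.card + if v ∈ W then 1 else 0 := by
  have h1 : (W ∩ insert v A) ∪ (W ∩ insert v B) = W := by
    ext u
    have := hc.cover u
    simp only [Finset.mem_union, Finset.mem_inter, Finset.mem_insert]
    tauto
  have h2 : (W ∩ insert v A) ∩ (W ∩ insert v B) = if v ∈ W then {v} else ∅ := by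
    ext u
    have := hc.disj u
    split_ifs with h
    · simp only [Finset.mem_inter, Finset.mem_insert, Finset.mem_singleton]
      constructor
      · tauto
      · rintro rfl; tauto
    · simp only [Finset.mem_inter, Finset.mem_insert, Finset.notMem_empty, iff_false]
      rintro ⟨⟨h3, h4⟩, -, h5⟩
      have : u ≠ v := by rintro rfl; exact h h3
      tauto
  have := Finset.card_union_add_card_inter (W ∩ insert v A) (W ∩ insert v B)
  rw [h1, h2] at this
  rw [← this]
  split_ifs <;> simp

theorem IsHingeCut.one_le_card_inter (_hc : IsHingeCut H s t v A B) {x : V} {W : Finset V}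
    (hxW : x ∈ W) (hx : x ∈ A) :
    1 ≤ (W ∩ insert v A).card :=
  Finset.card_pos.2 ⟨x, by simp [hxW, hx]⟩

theorem IsHingeCut.two_le_card_inter (hc : IsHingeCut H s t v A B) {x : V} {W : Finset V}
    (hxW : x ∈ W) (hx : x ∈ A) (hv : v ∈ W) :
    2 ≤ (W ∩ insert v A).card := by
  have : ({x, v} : Finset V) ⊆ W ∩ insert v A := by
    intro u
    simp only [Finset.mem_insert, Finset.mem_singleton, Finset.mem_inter]
    rintro (rfl | rfl) <;> simp [*]
  refine le_trans ?_ (Finset.card_le_card this)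
  rw [Finset.card_pair]
  rintro rfl
  exact hc.notMem_left hx

/-- The sparsity bound of planar rigidity. -/
theorem Erodible.edgesIn_add_three_le (h : Erodible s t k H) {W : Finset V} (hW : 2 ≤ W.card) :
    edgesIn H W + 3 ≤ 2 * W.card := by
  induction h generalizing W with
  | bot =>
    have : edgesIn (⊥ : SimpleGraph V) W = 0 := by simp [edgesIn]
    omega
  | @step k H v A B x y h hc hx hy ih =>
    by_cases hxy : x ∈ W ∧ y ∈ W
    · have h1 := edgesIn_sup_edge_le hc hx hy W
      have h2 := hc.edgesIn_le W
      have h3 := hc.card_inter W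
      have h4 := hc.one_le_card_inter hxy.1 hx
      have h5 := hc.symm.one_le_card_inter hxy.2 hy
      -- A single vertex spans `0 = 2·1 - 2` edges, so singletons violate the bound and need their
      -- own case.
      have h6 : edgesIn H (W ∩ insert v A) + 3 ≤ 2 * (W ∩ insert v A).card ∨
          (W ∩ insert v A).card = 1 ∧ edgesIn H (W ∩ insert v A) = 0 := by
        rcases h4.eq_or_lt with h4 | h4
        · exact Or.inr ⟨h4.symm, edgesIn_of_card_le_one _ h4.ge⟩
        · exact Or.inl (ih h4)
      have h7 : edgesIn H (W ∩ insert v B) + 3 ≤ 2 * (W ∩ insert v B).card ∨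
          (W ∩ insert v B).card = 1 ∧ edgesIn H (W ∩ insert v B) = 0 := by
        rcases h5.eq_or_lt with h5 | h5
        · exact Or.inr ⟨h5.symm, edgesIn_of_card_le_one _ h5.ge⟩
        · exact Or.inl (ih h5)
      -- With `v ∈ W` the sides have `a + b = |W| + 1` vertices and `(2a - 3) + (2b - 3) + 1 = 2|W|
      -- - 3`. With `v ∉ W` the bound is attained only by two singletons.
      split_ifs at h3 with hv
      · have h8 := hc.two_le_card_inter hxy.1 hx hv
        have h9 := hc.symm.two_le_card_inter hxy.2 hy hv
        omega
      · omega
    · rw [edgesIn_sup_edge_of_notMem hc hx hy hxy]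
      exact ih hW

/-- A set that meets both `A` and `B` gets its edges from its two parts alone, without the extra
crossing edge, so it falls at least one short of the sparsity bound. -/
theorem IsTight.subset_or_subset (h : Erodible s t k H) (hc : IsHingeCut H s t v A B)
    {W : Finset V} (hW : IsTight H W) : W ⊆ insert v A ∨ W ⊆ insert v B := by
  by_contra! hcon
  obtain ⟨⟨x, hxW, hx⟩, ⟨y, hyW, hy⟩⟩ := And.imp Finset.not_subset.1 Finset.not_subset.1 hcon
  replace hx : x ∈ B := by
    have := hc.cover x
    simp only [Finset.mem_insert] at hx
    tauto
  replace hy : y ∈ A := by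
    have := hc.cover y
    simp only [Finset.mem_insert] at hy
    tauto
  have h2 := hc.edgesIn_le W
  have h3 := hc.card_inter W
  have h4 := hc.one_le_card_inter hyW hy
  have h5 := hc.symm.one_le_card_inter hxW hx
  have h6 : edgesIn H (W ∩ insert v A) + 3 ≤ 2 * (W ∩ insert v A).card ∨
      (W ∩ insert v A).card = 1 ∧ edgesIn H (W ∩ insert v A) = 0 := by
    rcases h4.eq_or_lt with h4 | h4
    · exact Or.inr ⟨h4.symm, edgesIn_of_card_le_one _ h4.ge⟩
    · exact Or.inl (h.edgesIn_add_three_le h4)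
  have h7 : edgesIn H (W ∩ insert v B) + 3 ≤ 2 * (W ∩ insert v B).card ∨
      (W ∩ insert v B).card = 1 ∧ edgesIn H (W ∩ insert v B) = 0 := by
    rcases h5.eq_or_lt with h5 | h5
    · exact Or.inr ⟨h5.symm, edgesIn_of_card_le_one _ h5.ge⟩
    · exact Or.inl (h.edgesIn_add_three_le h5)
  obtain ⟨h8, h9⟩ := hW
  split_ifs at h3 with hv
  · have h8 := hc.two_le_card_inter hyW hy hv
    have h9 := hc.symm.two_le_card_inter hxW hx hv
    omega
  · omega

/-- Equality in the sparsity induction forces equality on both sides and `v ∈ W`. The only other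
tight case is `W = {x, y}`, which `3 ≤ W.card` rules out. -/
theorem IsTight.split (h : Erodible s t k H) (hc : IsHingeCut H s t v A B) {x y : V}
    (hx : x ∈ A) (hy : y ∈ B) {W : Finset V} (hW : IsTight (H ⊔ SimpleGraph.edge x y) W)
    (hxW : x ∈ W) (hyW : y ∈ W) (h3W : 3 ≤ W.card) :
    v ∈ W ∧ IsTight H (W ∩ insert v A) ∧ IsTight H (W ∩ insert v B) := by
  have h1 := edgesIn_sup_edge_le hc hx hy W
  have h2 := hc.edgesIn_le W
  have h3 := hc.card_inter W
  have h4 := hc.one_le_card_inter hxW hx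
  have h5 := hc.symm.one_le_card_inter hyW hy
  have h6 : 2 ≤ (W ∩ insert v A).card → edgesIn H (W ∩ insert v A) + 3 ≤
    2 * (W ∩ insert v A).card := fun h4 => h.edgesIn_add_three_le h4
  have h6' : (W ∩ insert v A).card ≤ 1 → edgesIn H (W ∩ insert v A) = 0 :=
    fun h4 => edgesIn_of_card_le_one _ h4
  have h7 : 2 ≤ (W ∩ insert v B).card → edgesIn H (W ∩ insert v B) + 3 ≤
    2 * (W ∩ insert v B).card := fun h4 => h.edgesIn_add_three_le h4
  have h7' : (W ∩ insert v B).card ≤ 1 → edgesIn H (W ∩ insert v B) = 0 :=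
    fun h4 => edgesIn_of_card_le_one _ h4
  obtain ⟨h8, h9⟩ := hW
  unfold IsTight
  split_ifs at h3 with hv
  · have h8 := hc.two_le_card_inter hxW hx hv
    have h9 := hc.symm.two_le_card_inter hyW hy hv
    refine ⟨hv, ⟨h8, ?_⟩, ⟨h9, ?_⟩⟩ <;> omega
  · omega

end

/-! ### Equality in the sparsity bound is impossible -/

section
variable {V : Type*} {H : SimpleGraph V} {s t k : ℕ} {v : V} {A B : Finset V}

theorem not_isTight_bot (W : Finset V) : ¬ IsTight (⊥ : SimpleGraph V) W := by
  rintro ⟨-, h⟩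
  have : edgesIn (⊥ : SimpleGraph V) W = 0 := by simp [edgesIn]
  omega

theorem sup_edge_adj_self {x y : V} (h : x ≠ y) : (H ⊔ SimpleGraph.edge x y).Adj x y := by
  simp [SimpleGraph.edge_adj, h]

variable [DecidableEq V]

theorem IsHingeCut.subset_side_of_adj (hc : IsHingeCut H s t v A B) {a b : V} (h : H.Adj a b) :
    (a ∈ insert v A ∧ b ∈ insert v A) ∨ (a ∈ insert v B ∧ b ∈ insert v B) := by
  simp only [Finset.mem_insert]
  rcases hc.cover a with h1 | h1 | h1 <;> rcases hc.cover b with h2 | h2 | h2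
  · exact Or.inl ⟨Or.inl h1, Or.inl h2⟩
  · exact Or.inl ⟨Or.inl h1, Or.inr h2⟩
  · exact Or.inr ⟨Or.inl h1, Or.inr h2⟩
  · exact Or.inl ⟨Or.inr h1, Or.inl h2⟩
  · exact Or.inl ⟨Or.inr h1, Or.inr h2⟩
  · exact absurd h (hc.not_adj a h1 b h2)
  · exact Or.inr ⟨Or.inr h1, Or.inl h2⟩
  · exact absurd h.symm (hc.not_adj b h2 a h1)
  · exact Or.inr ⟨Or.inr h1, Or.inr h2⟩

theorem IsHingeCut.mem_insert_or (hc : IsHingeCut H s t v A B) (u : V) :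
    u ∈ insert v A ∨ u ∈ insert v B := by
  rcases hc.cover u with h | h | h
  exacts [Or.inl (Finset.mem_insert.2 (Or.inl h)), Or.inl (Finset.mem_insert_of_mem h),
    Or.inr (Finset.mem_insert_of_mem h)]

theorem IsHingeCut.eq_insert (hc : IsHingeCut H s t v A B) {P : Finset V}
    (hP : P ⊆ insert v A) (hcard : P.card = s + 1) : P = insert v A :=
  Finset.eq_of_subset_of_card_le hP
    ((Finset.card_insert_le _ _).trans (by rw [hc.card_left, hcard]))

/-- With `y` from the other side, `P` would have `s + 2` vertices. Most contradictions below end in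
this count. -/
theorem IsHingeCut.insert_not_subset (hc : IsHingeCut H s t v A B) {P : Finset V}
    (hcard : P.card ≤ s + 1) {y : V} (hy : y ∈ B) (hyP : y ∈ P) : ¬ insert v A ⊆ P := by
  intro h
  have h1 : insert y (insert v A) ⊆ P := Finset.insert_subset hyP h
  have h2 := Finset.card_le_card h1
  rw [Finset.card_insert_of_notMem, Finset.card_insert_of_notMem hc.notMem_left,
    hc.card_left] at h2
  · omega
  · have h3 := fun h => hc.disj y h hy
    have h4 : y ≠ v := by rintro rfl; exact hc.notMem_right hy
    simp only [Finset.mem_insert]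
    tauto

/-- An erodible graph does not consist of small tight blocks sharing one vertex. -/
theorem Erodible.not_star (h : Erodible s t k H) (hs : 2 ≤ s) (hst : s < t) (c : V)
    (𝓑 : Set (Finset V)) (tight : ∀ W ∈ 𝓑, IsTight H W) (center : ∀ W ∈ 𝓑, c ∈ W)
    (card : ∀ W ∈ 𝓑, W.card ≤ s + 1) (cover : ∀ u, ∃ W ∈ 𝓑, u ∈ W)
    (edge : ∀ x y, H.Adj x y → ∃ W ∈ 𝓑, x ∈ W ∧ y ∈ W)
    (inter : ∀ W ∈ 𝓑, ∀ W' ∈ 𝓑, W ≠ W' → ∀ u ∈ W, u ∈ W' → u = c) : False := by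
  induction h generalizing 𝓑 with
  | bot =>
    obtain ⟨W, hW, -⟩ := cover c
    exact not_isTight_bot W (tight W hW)
  | @step k H v A B x y h hc hx hy ih =>
    have hxy := hc.ne hx hy
    obtain ⟨W, hW, hxW, hyW⟩ := edge x y (sup_edge_adj_self hxy)
    have htight : ∀ W' ∈ 𝓑, W' ≠ W → IsTight H W' := by
      intro W' hW' hne
      refine (tight W' hW').of_sup_edge hc hx hy ?_
      rintro ⟨h1, h2⟩
      exact hxy ((inter _ hW' _ hW hne _ h1 hxW).trans (inter _ hW' _ hW hne _ h2 hyW).symm)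
    -- The blocks other than `W` stay tight and contain `c`, so they lie in `insert v A`; only `W`
    -- can cover `B`.
    have hB : c ∈ A → B ⊆ W := by
      intro hcA u hu
      obtain ⟨W', hW', huW'⟩ := cover u
      by_cases hne : W' = W
      · rwa [← hne]
      exfalso
      rcases (htight W' hW' hne).subset_or_subset h hc with h1 | h1
      · rcases Finset.mem_insert.1 (h1 huW') with rfl | h2
        · exact hc.notMem_right hu
        · exact hc.disj u h2 hu
      · rcases Finset.mem_insert.1 (h1 (center W' hW')) with rfl | h2
        · exact hc.notMem_left hcA
        · exact hc.disj c hcA h2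
    have hA : c ∈ B → A ⊆ W := by
      intro hcA u hu
      obtain ⟨W', hW', huW'⟩ := cover u
      by_cases hne : W' = W
      · rwa [← hne]
      exfalso
      rcases (htight W' hW' hne).subset_or_subset h hc with h1 | h1
      · rcases Finset.mem_insert.1 (h1 (center W' hW')) with rfl | h2
        · exact hc.notMem_right hcA
        · exact hc.disj c h2 hcA
      · rcases Finset.mem_insert.1 (h1 huW') with rfl | h2
        · exact hc.notMem_left hu
        · exact hc.disj u hu h2
    have hcW := center W hW
    have hWs := card W hW
    have h2W := (tight W hW).1
    by_cases h3W : 3 ≤ W.card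
    · obtain ⟨hv, t1, t2⟩ := (tight W hW).split h hc hx hy hxW hyW h3W
      rcases hc.cover c with rfl | hcA | hcB
      -- When the hinge is the centre, `W` splits into two smaller blocks through `c` and the star
      -- pattern survives.
      · refine ih ({W' | W' ∈ 𝓑 ∧ W' ≠ W} ∪ {W ∩ insert c A, W ∩ insert c B}) ?_ ?_ ?_ ?_ ?_ ?_
        · rintro W' (h1 | rfl | rfl)
          exacts [htight W' h1.1 h1.2, t1, t2]
        · rintro W' (h1 | rfl | rfl)
          exacts [center W' h1.1, Finset.mem_inter.2 ⟨hv, Finset.mem_insert_self _ _⟩,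
            Finset.mem_inter.2 ⟨hv, Finset.mem_insert_self _ _⟩]
        · rintro W' (h1 | rfl | rfl)
          exacts [card W' h1.1, (Finset.card_le_card Finset.inter_subset_left).trans hWs,
            (Finset.card_le_card Finset.inter_subset_left).trans hWs]
        · intro u
          obtain ⟨W', hW', hu⟩ := cover u
          by_cases hne : W' = W
          · subst hne
            rcases hc.mem_insert_or u with h1 | h1
            · exact ⟨_, Or.inr (Or.inl rfl), Finset.mem_inter.2 ⟨hu, h1⟩⟩
            · exact ⟨_, Or.inr (Or.inr rfl), Finset.mem_inter.2 ⟨hu, h1⟩⟩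
          · exact ⟨W', Or.inl ⟨hW', hne⟩, hu⟩
        · intro a b hab
          obtain ⟨W', hW', ha, hb⟩ := edge a b (Or.inl hab)
          by_cases hne : W' = W
          · subst hne
            rcases hc.subset_side_of_adj hab with ⟨h1, h2⟩ | ⟨h1, h2⟩
            · exact ⟨_, Or.inr (Or.inl rfl), Finset.mem_inter.2 ⟨ha, h1⟩,
                Finset.mem_inter.2 ⟨hb, h2⟩⟩
            · exact ⟨_, Or.inr (Or.inr rfl), Finset.mem_inter.2 ⟨ha, h1⟩,
                Finset.mem_inter.2 ⟨hb, h2⟩⟩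
          · exact ⟨W', Or.inl ⟨hW', hne⟩, ha, hb⟩
        · have key : ∀ u ∈ W ∩ insert c A, u ∈ W ∩ insert c B → u = c := by
            intro u h1 h2
            rcases Finset.mem_insert.1 (Finset.mem_inter.1 h1).2 with h3 | h3
            · exact h3
            rcases Finset.mem_insert.1 (Finset.mem_inter.1 h2).2 with h4 | h4
            · exact h4
            exact absurd h4 (hc.disj u h3)
          rintro W' (h1 | rfl | rfl) W'' (h2 | rfl | rfl) hne u hu1 hu2
          · exact inter _ h1.1 _ h2.1 hne u hu1 hu2
          · exact inter _ h1.1 _ hW h1.2 u hu1 (Finset.mem_inter.1 hu2).1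
          · exact inter _ h1.1 _ hW h1.2 u hu1 (Finset.mem_inter.1 hu2).1
          · exact inter _ h2.1 _ hW h2.2 u hu2 (Finset.mem_inter.1 hu1).1
          · exact absurd rfl hne
          · exact key u hu1 hu2
          · exact inter _ h2.1 _ hW h2.2 u hu2 (Finset.mem_inter.1 hu1).1
          · exact key u hu2 hu1
          · exact absurd rfl hne
      -- Here `W` contains `B` and `v`, so `t + 1 ≤ s + 1`, against `s < t`.
      · have h4 := Finset.card_le_card (Finset.insert_subset hv (hB hcA))
        rw [Finset.card_insert_of_notMem hc.notMem_right, hc.card_right] at h4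
        omega
      · exact hc.insert_not_subset hWs hcB hcW (Finset.insert_subset hv (hA hcB))
    · obtain hcA | hcB : c ∈ A ∨ c ∈ B := by
        have h5 : W = {x, y} := by
          refine (Finset.eq_of_subset_of_card_le ?_ ?_).symm
          · simp [Finset.insert_subset_iff, hxW, hyW]
          · rw [Finset.card_pair hxy]; omega
        rw [h5] at hcW
        rcases Finset.mem_insert.1 hcW with rfl | h6
        · exact Or.inl hx
        · rw [Finset.mem_singleton.1 h6]; exact Or.inr hy
      · have h4 := Finset.card_le_card (hB hcA)
        rw [hc.card_right] at h4
        omega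
      · have h4 := Finset.card_le_card (Finset.insert_subset hcW (hA hcB))
        rw [Finset.card_insert_of_notMem (fun h => hc.disj c h hcB), hc.card_left] at h4
        omega

/-- An erodible graph does not consist of a tight block with `s + 1` vertices and, disjoint from
it, tight blocks with `s + 1` vertices sharing one vertex. -/
theorem Erodible.not_detached_block (h : Erodible s t k H) (hs : 2 ≤ s) (hst : s < t)
    (P₁ : Finset V) (tight₁ : IsTight H P₁) (card₁ : P₁.card = s + 1) (y : V) (hyP₁ : y ∉ P₁)
    (𝓑 : Set (Finset V)) (tight : ∀ W ∈ 𝓑, IsTight H W) (center : ∀ W ∈ 𝓑, y ∈ W)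
    (card : ∀ W ∈ 𝓑, W.card = s + 1) (cover : ∀ u, u ∈ P₁ ∨ u = y ∨ ∃ W ∈ 𝓑, u ∈ W)
    (edge : ∀ x y, H.Adj x y → (x ∈ P₁ ∧ y ∈ P₁) ∨ ∃ W ∈ 𝓑, x ∈ W ∧ y ∈ W)
    (disj : ∀ W ∈ 𝓑, ∀ u ∈ W, u ∉ P₁)
    (inter : ∀ W ∈ 𝓑, ∀ W' ∈ 𝓑, W ≠ W' → ∀ u ∈ W, u ∈ W' → u = y) : False := by
  cases h with
  | bot => exact not_isTight_bot _ tight₁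
  | @step k H v A B a b h hc ha hb =>
    have hab := hc.ne ha hb
    rcases edge a b (sup_edge_adj_self hab) with ⟨haP, hbP⟩ | ⟨W, hW, haW, hbW⟩
    · obtain ⟨hv, t1, t2⟩ := tight₁.split h hc ha hb haP hbP (by omega)
      have hvy : y ≠ v := by rintro rfl; exact hyP₁ hv
      -- The last edge lies in `P₁`. The other blocks avoid `P₁`, stay tight and contain `y ≠ v`, so
      -- they lie on the side of `y`. Then `P₁` must contain all of the opposite side together with
      -- `v`, and also an end of the edge on the side of `y`.
      have hside : ∀ W ∈ 𝓑, W ⊆ insert v A ∨ W ⊆ insert v B := fun W hW =>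
        ((tight W hW).of_sup_edge hc ha hb fun h1 => disj W hW a h1.1 haP).subset_or_subset h hc
      rcases hc.cover y with rfl | hyA | hyB
      · exact hvy rfl
      · have h1 : insert v B ⊆ P₁ := by
          refine Finset.insert_subset hv fun u hu => ?_
          rcases cover u with h1 | rfl | ⟨W, hW, huW⟩
          · exact h1
          · exact absurd hu (hc.disj u hyA)
          · exfalso
            rcases hside W hW with h2 | h2
            · rcases Finset.mem_insert.1 (h2 huW) with rfl | h3
              · exact hc.notMem_right hu
              · exact hc.disj u h3 hu
            · rcases Finset.mem_insert.1 (h2 (center W hW)) with rfl | h3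
              · exact hvy rfl
              · exact hc.disj y hyA h3
        exact hc.symm.insert_not_subset (by omega) ha haP h1
      · have h1 : insert v A ⊆ P₁ := by
          refine Finset.insert_subset hv fun u hu => ?_
          rcases cover u with h1 | rfl | ⟨W, hW, huW⟩
          · exact h1
          · exact absurd hyB (hc.disj u hu)
          · exfalso
            rcases hside W hW with h2 | h2
            · rcases Finset.mem_insert.1 (h2 (center W hW)) with rfl | h3
              · exact hvy rfl
              · exact hc.disj y h3 hyB
            · rcases Finset.mem_insert.1 (h2 huW) with rfl | h3
              · exact hc.notMem_left hu
              · exact hc.disj u hu h3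
        exact hc.insert_not_subset (by omega) hb hbP h1
    · have hWs := card W hW
      obtain ⟨hv, t1, t2⟩ := (tight W hW).split h hc ha hb haW hbW (by omega)
      -- The last edge lies in `W`. A block of size `s + 1` on the left equals `insert v A`: for
      -- `P₁` this contradicts `v ∉ P₁`, and another block of the family would share both `a` and
      -- `v` with `W`. So `W` alone covers `A`, and it is too large.
      have hvP : v ∉ P₁ := disj W hW v hv
      have hP₁ : P₁ ⊆ insert v B := by
        refine ((tight₁.of_sup_edge hc ha hb fun h1 =>
          disj W hW a haW h1.1).subset_or_subset h hc).resolve_left fun h1 => ?_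
        rw [hc.eq_insert h1 card₁] at hvP
        exact hvP (Finset.mem_insert_self _ _)
      have hside : ∀ W' ∈ 𝓑, W' ≠ W → W' ⊆ insert v B := by
        intro W' hW' hne
        have h0 := inter W' hW' W hW hne
        refine (((tight W' hW').of_sup_edge hc ha hb fun h1 =>
          hab ((h0 a h1.1 haW).trans (h0 b h1.2 hbW).symm)).subset_or_subset h hc).resolve_left
            fun h1 => ?_
        have h2 := hc.eq_insert h1 (card W' hW')
        have h3 := h0 a (by rw [h2]; exact Finset.mem_insert_of_mem ha) haW
        have h4 := h0 v (by rw [h2]; exact Finset.mem_insert_self _ _) hv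
        rw [← h4] at h3
        exact hc.notMem_left (h3 ▸ ha)
      have hdis : ∀ u ∈ A, u ∉ insert v B := by
        intro u hu h1
        rcases Finset.mem_insert.1 h1 with rfl | h3
        · exact hc.notMem_left hu
        · exact hc.disj u hu h3
      have h1 : insert v A ⊆ W := by
        refine Finset.insert_subset hv fun u hu => ?_
        rcases cover u with h1 | rfl | ⟨W', hW', huW⟩
        · exact absurd (hP₁ h1) (hdis u hu)
        · exact center W hW
        · by_cases hne : W' = W
          · rwa [← hne]
          · exact absurd (hside W' hW' hne huW) (hdis u hu)
      exact hc.insert_not_subset (by omega) hb hbW h1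

/-- An erodible graph does not consist of a tight core and of tight blocks with `s + 1` vertices,
each attached to the core at one vertex. -/
theorem Erodible.not_core_with_petals (h : Erodible s t k H) (hs : 2 ≤ s) (hst : s < t)
    (Q : Finset V) (𝓟 : Set (Finset V)) (tightQ : IsTight H Q) (tight : ∀ P ∈ 𝓟, IsTight H P)
    (card : ∀ P ∈ 𝓟, P.card = s + 1)
    (attach : ∀ P ∈ 𝓟, ∃ c ∈ P, c ∈ Q ∧ ∀ u ∈ P, u ∈ Q → u = c)
    (cover : ∀ u, u ∈ Q ∨ ∃ P ∈ 𝓟, u ∈ P)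
    (edge : ∀ x y, H.Adj x y → (x ∈ Q ∧ y ∈ Q) ∨ ∃ P ∈ 𝓟, x ∈ P ∧ y ∈ P)
    (inter : ∀ P ∈ 𝓟, ∀ P' ∈ 𝓟, P ≠ P' → ∀ u ∈ P, u ∈ P' → u ∈ Q) : False := by
  induction h generalizing Q 𝓟 with
  | bot => exact not_isTight_bot _ tightQ
  | @step k H v A B x y h hc hx hy ih =>
    have hxy := hc.ne hx hy
    have uniq : ∀ P ∈ 𝓟, ∀ u ∈ P, u ∈ Q → ∀ w ∈ P, w ∈ Q → u = w := by
      intro P hP u hu hu' w hw hw'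
      obtain ⟨c, -, -, h1⟩ := attach P hP
      exact (h1 u hu hu').trans (h1 w hw hw').symm
    have hdisA : ∀ u ∈ A, u ∉ insert v B := by
      intro u hu h1
      rcases Finset.mem_insert.1 h1 with rfl | h3
      · exact hc.notMem_left hu
      · exact hc.disj u hu h3
    have hdisB : ∀ u ∈ B, u ∉ insert v A := by
      intro u hu h1
      rcases Finset.mem_insert.1 h1 with rfl | h3
      · exact hc.notMem_right hu
      · exact hc.disj u h3 hu
    have hxv : x ≠ v := by rintro rfl; exact hc.notMem_left hx
    rcases edge x y (sup_edge_adj_self hxy) with ⟨hxQ, hyQ⟩ | ⟨P, hP, hxP, hyP⟩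
    · have htight : ∀ P ∈ 𝓟, IsTight H P := fun P hP =>
        (tight P hP).of_sup_edge hc hx hy fun h1 => hxy (uniq P hP x h1.1 hxQ y h1.2 hyQ)
      have hside := fun P hP => (htight P hP).subset_or_subset h hc
      by_cases h3Q : 3 ≤ Q.card
      · obtain ⟨hv, t1, t2⟩ := tightQ.split h hc hx hy hxQ hyQ h3Q
        -- A petal on the left would be all of `insert v A` and meet the core in both `x` and `v`.
        have hsideB : ∀ P ∈ 𝓟, P ⊆ insert v B := by
          intro P hP
          refine (hside P hP).resolve_left fun h1 => ?_
          have h2 := hc.eq_insert h1 (card P hP)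
          exact hxv (uniq P hP x (by rw [h2]; exact Finset.mem_insert_of_mem hx) hxQ v
            (by rw [h2]; exact Finset.mem_insert_self _ _) hv)
        have hAQ : insert v A ⊆ Q := by
          refine Finset.insert_subset hv fun u hu => ?_
          refine (cover u).resolve_right ?_
          rintro ⟨P, hP, huP⟩
          exact hdisA u hu (hsideB P hP huP)
        rw [Finset.inter_eq_right.2 hAQ] at t1
        -- The left half of the core has become a new petal, attached at `v`; the right half is the
        -- new core.
        refine ih (Q ∩ insert v B) (insert (insert v A) 𝓟) t2 ?_ ?_ ?_ ?_ ?_ ?_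
        · rintro P (rfl | hP)
          exacts [t1, htight P hP]
        · rintro P (rfl | hP)
          · rw [Finset.card_insert_of_notMem hc.notMem_left, hc.card_left]
          · exact card P hP
        · rintro P (rfl | hP)
          · refine ⟨v, by simp, by simp [hv], fun u hu hu' => ?_⟩
            have h1 := hdisA u
            simp only [Finset.mem_inter] at hu'
            exact (Finset.mem_insert.1 hu).resolve_right fun h2 => h1 h2 hu'.2
          · obtain ⟨c, hcP, hcQ, h1⟩ := attach P hP
            exact ⟨c, hcP, Finset.mem_inter.2 ⟨hcQ, hsideB P hP hcP⟩,
              fun u hu hu' => h1 u hu (Finset.mem_inter.1 hu').1⟩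
        · intro u
          rcases cover u with h1 | ⟨P, hP, h1⟩
          · rcases hc.mem_insert_or u with h2 | h2
            · exact Or.inr ⟨_, Or.inl rfl, h2⟩
            · exact Or.inl (Finset.mem_inter.2 ⟨h1, h2⟩)
          · exact Or.inr ⟨P, Or.inr hP, h1⟩
        · intro a b hab
          rcases edge a b (Or.inl hab) with ⟨ha, hb⟩ | ⟨P, hP, h1⟩
          · rcases hc.subset_side_of_adj hab with h1 | ⟨h1, h2⟩
            · exact Or.inr ⟨_, Or.inl rfl, h1⟩
            · exact Or.inl ⟨Finset.mem_inter.2 ⟨ha, h1⟩, Finset.mem_inter.2 ⟨hb, h2⟩⟩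
          · exact Or.inr ⟨P, Or.inr hP, h1⟩
        · rintro P (rfl | hP) P' (rfl | hP') hne u hu hu'
          · exact absurd rfl hne
          · exact Finset.mem_inter.2 ⟨hAQ hu, hsideB P' hP' hu'⟩
          · exact Finset.mem_inter.2 ⟨hAQ hu', hsideB P hP hu⟩
          · exact Finset.mem_inter.2 ⟨inter P hP P' hP' hne u hu hu', hsideB P hP hu⟩
      -- The core is the last edge itself and disappears. Its petal at `x` must be `insert v A`; the
      -- remaining petals hang at `y`, which is the detached pattern.
      · have hQ : Q = {x, y} := by
          refine (Finset.eq_of_subset_of_card_le ?_ ?_).symm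
          · simp [Finset.insert_subset_iff, hxQ, hyQ]
          · rw [Finset.card_pair hxy]; omega
        have hvQ : v ∉ Q := by
          rw [hQ]
          simp only [Finset.mem_insert, Finset.mem_singleton, not_or]
          refine ⟨hxv.symm, ?_⟩
          rintro rfl
          exact hc.notMem_right hy
        have hxP : ∀ P ∈ 𝓟, x ∈ P → P = insert v A := fun P hP hxP =>
          hc.eq_insert ((hside P hP).resolve_right fun h1 => hdisA x hx (h1 hxP)) (card P hP)
        have hyP : ∀ P ∈ 𝓟, y ∈ P → P ⊆ insert v B := fun P hP hyP =>
          (hside P hP).resolve_left fun h1 => hdisB y hy (h1 hyP)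
        have hor : ∀ P ∈ 𝓟, x ∈ P ∨ y ∈ P := by
          intro P hP
          obtain ⟨c, hcP, hcQ, -⟩ := attach P hP
          rw [hQ] at hcQ
          rcases Finset.mem_insert.1 hcQ with rfl | h1
          · exact Or.inl hcP
          · rw [Finset.mem_singleton.1 h1] at hcP; exact Or.inr hcP
        have hmem : insert v A ∈ 𝓟 := by
          by_contra hcon
          have h1 : A ⊆ {x} := by
            intro u hu
            rcases cover u with h1 | ⟨P, hP, h1⟩
            · rw [hQ] at h1
              rcases Finset.mem_insert.1 h1 with rfl | h1
              · simp
              · rw [Finset.mem_singleton.1 h1] at hu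
                exact absurd hy (hc.disj y hu)
            · rcases hor P hP with h2 | h2
              · exact absurd (hxP P hP h2 ▸ hP) hcon
              · exact absurd (hyP P hP h2 h1) (hdisA u hu)
          have h2 := Finset.card_le_card h1
          rw [hc.card_left, Finset.card_singleton] at h2
          omega
        have hyA : y ∉ insert v A := hdisB y hy
        have hoth : ∀ P ∈ 𝓟, P ≠ insert v A → y ∈ P ∧ ∀ u ∈ P, u ∉ insert v A := by
          intro P hP hne
          have h1 := (hor P hP).resolve_left fun h1 => hne (hxP P hP h1)
          refine ⟨h1, fun u hu hu' => ?_⟩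
          have h2 := inter P hP _ hmem hne u hu hu'
          rw [hQ] at h2
          rcases Finset.mem_insert.1 h2 with rfl | h2
          · exact hne (hxP P hP hu)
          · rw [Finset.mem_singleton.1 h2] at hu'
            exact hyA hu'
        refine h.not_detached_block hs hst (insert v A) (htight _ hmem) (card _ hmem) y hyA
          {P | P ∈ 𝓟 ∧ P ≠ insert v A} (fun P hP => htight P hP.1)
          (fun P hP => (hoth P hP.1 hP.2).1) (fun P hP => card P hP.1) ?_ ?_
          (fun P hP => (hoth P hP.1 hP.2).2) ?_
        · intro u
          rcases cover u with h1 | ⟨P, hP, h1⟩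
          · rw [hQ] at h1
            rcases Finset.mem_insert.1 h1 with rfl | h1
            · exact Or.inl (Finset.mem_insert_of_mem hx)
            · exact Or.inr (Or.inl (Finset.mem_singleton.1 h1))
          · by_cases hne : P = insert v A
            · exact Or.inl (hne ▸ h1)
            · exact Or.inr (Or.inr ⟨P, ⟨hP, hne⟩, h1⟩)
        · intro a b hab
          rcases edge a b (Or.inl hab) with ⟨ha, hb⟩ | ⟨P, hP, h1⟩
          · exfalso
            have hn := hc.not_adj x hx y hy
            rw [hQ, Finset.mem_insert, Finset.mem_singleton] at ha hb
            rcases ha with rfl | rfl <;> rcases hb with rfl | rfl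
            exacts [H.loopless.irrefl _ hab, hn hab, hn hab.symm, H.loopless.irrefl _ hab]
          · by_cases hne : P = insert v A
            · exact Or.inl (hne ▸ h1)
            · exact Or.inr ⟨P, ⟨hP, hne⟩, h1⟩
        · intro P hP P' hP' hne u hu hu'
          exact uniq P hP.1 u hu (inter P hP.1 P' hP'.1 hne u hu hu') y (hoth P hP.1 hP.2).1 hyQ
    · have hPs := card P hP
      obtain ⟨hv, t1, t2⟩ := (tight P hP).split h hc hx hy hxP hyP (by omega)
      have hsideB : ∀ P' ∈ 𝓟, P' ≠ P → P' ⊆ insert v B := by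
        intro P' hP' hne
        have h0 : ∀ u ∈ P', u ∈ P → u ∈ Q := inter P' hP' P hP hne
        refine (((tight P' hP').of_sup_edge hc hx hy fun h1 => hxy
          (uniq P hP x hxP (h0 x h1.1 hxP) y hyP (h0 y h1.2 hyP))).subset_or_subset
            h hc).resolve_left fun h1 => ?_
        have h2 := hc.eq_insert h1 (card P' hP')
        exact hxv (uniq P hP x hxP (h0 x (by rw [h2]; exact Finset.mem_insert_of_mem hx) hxP) v hv
          (h0 v (by rw [h2]; exact Finset.mem_insert_self _ _) hv))
      rcases (tightQ.of_sup_edge hc hx hy fun h1 =>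
        hxy (uniq P hP x hxP h1.1 y hyP h1.2)).subset_or_subset h hc with hQ | hQ
      -- The core is left of the cut and the petals other than `P` are right of it, so these petals
      -- meet the core at `v`. Another petal exists, since `P` alone cannot cover `B`. All blocks
      -- then pass through `v` and have at most `s + 1` vertices: a star.
      · obtain ⟨P', hP', hne⟩ : ∃ P' ∈ 𝓟, P' ≠ P := by
          by_contra! hcon
          have h1 : insert v B ⊆ P := by
            refine Finset.insert_subset hv fun u hu => ?_
            rcases cover u with h1 | ⟨P', hP', h1⟩
            · exact absurd (hQ h1) (hdisB u hu)
            · rwa [← hcon P' hP']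
          exact hc.symm.insert_not_subset (by omega) hx hxP h1
        have hvc : ∀ P' ∈ 𝓟, P' ≠ P → v ∈ P' ∧ v ∈ Q := by
          intro P' hP' hne
          obtain ⟨c, hcP, hcQ, -⟩ := attach P' hP'
          have : c = v := (Finset.mem_insert.1 (hQ hcQ)).resolve_right fun h1 =>
            hdisA c h1 (hsideB P' hP' hne hcP)
          rw [← this]
          exact ⟨hcP, hcQ⟩
        have hvQ := (hvc P' hP' hne).2
        have hvP : ∀ P' ∈ 𝓟, v ∈ P' := by
          intro P' hP'
          by_cases h1 : P' = P
          · rwa [h1]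
          · exact (hvc P' hP' h1).1
        -- The star is found in the graph that still has its last edge, so no block has to be split.
        refine (h.step hc hx hy).not_star hs hst v (insert Q 𝓟) ?_ ?_ ?_ ?_ ?_ ?_
        · rintro W (rfl | hW)
          exacts [tightQ, tight W hW]
        · rintro W (rfl | hW)
          exacts [hvQ, hvP W hW]
        · rintro W (rfl | hW)
          · have := Finset.card_le_card hQ
            rwa [Finset.card_insert_of_notMem hc.notMem_left, hc.card_left] at this
          · exact (card W hW).le
        · intro u
          rcases cover u with h1 | ⟨P, hP, h1⟩
          exacts [⟨Q, Or.inl rfl, h1⟩, ⟨P, Or.inr hP, h1⟩]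
        · intro a b hab
          rcases edge a b hab with h1 | ⟨P, hP, h1⟩
          exacts [⟨Q, Or.inl rfl, h1⟩, ⟨P, Or.inr hP, h1⟩]
        · rintro W (rfl | hW) W' (rfl | hW') hne u hu hu'
          · exact absurd rfl hne
          · exact uniq W' hW' u hu' hu v (hvP W' hW') hvQ
          · exact uniq W hW u hu hu' v (hvP W hW) hvQ
          · exact uniq W hW u hu (inter W hW W' hW' hne u hu hu') v (hvP W hW) hvQ
      · have h1 : insert v A ⊆ P := by
          refine Finset.insert_subset hv fun u hu => ?_
          rcases cover u with h1 | ⟨P', hP', h1⟩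
          · exact absurd (hQ h1) (hdisA u hu)
          · by_cases hne : P' = P
            · rwa [← hne]
            · exact absurd (hsideB P' hP' hne h1) (hdisA u hu)
        exact hc.insert_not_subset (by omega) hy hyP h1

theorem Erodible.le [Fintype V] (h : Erodible s t k H) (hs : 2 ≤ s) (hst : s < t)
    (hV : Fintype.card V = s + t + 1) : k ≤ 2 * s + 2 * t - 2 := by
  have h1 : (Finset.univ : Finset V).card = s + t + 1 := hV
  have h2 := h.edgesIn_add_three_le (W := Finset.univ) (by omega)
  have h3 := edgesIn_univ H
  rw [h.ncard_edgeSet] at h3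
  -- The sparsity bound reads `k ≤ 2(s + t + 1) - 3 = 2s + 2t - 1`; in the case of equality the
  -- whole vertex set is a tight core without petals.
  by_contra! hcon
  refine h.not_core_with_petals hs hst Finset.univ ∅ ⟨by omega, by omega⟩ ?_ ?_ ?_ ?_ ?_ ?_ <;>
    simp

end

/-! ### Weak saturation as erodibility of the complement -/

theorem IsHingeCut.of_copy {V : Type*} [Fintype V] {s t : ℕ} (hV : Fintype.card V = s + t + 1)
    {J : SimpleGraph V} (f : SimpleGraph.Copy (completeBipartiteGraph (Fin s) (Fin t)) J) :
    ∃ v A B, IsHingeCut Jᶜ s t v A B ∧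
      ∀ q ∈ f.toSubgraph.edgeSet, ∃ x ∈ A, ∃ y ∈ B, q = s(x, y) := by
  classical
  have hinj := f.injective
  set A : Finset V := Finset.univ.map ⟨fun i => f (Sum.inl i), fun i j h => Sum.inl_injective (hinj h)⟩
    with hA
  set B : Finset V := Finset.univ.map ⟨fun i => f (Sum.inr i), fun i j h => Sum.inr_injective (hinj h)⟩
    with hB
  have hAc : A.card = s := by simp [hA]
  have hBc : B.card = t := by simp [hB]
  have hdis : ∀ u ∈ A, u ∉ B := by
    intro u hu hu'
    simp only [hA, hB, Finset.mem_map, Finset.mem_univ, true_and] at hu hu'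
    obtain ⟨i, rfl⟩ := hu
    obtain ⟨j, hj⟩ := hu'
    cases hinj hj
  have hcard : (A ∪ B)ᶜ.card = 1 := by
    rw [Finset.card_compl, Finset.card_union_of_disjoint (Finset.disjoint_left.2 hdis), hAc, hBc, hV]
    omega
  obtain ⟨v, hv⟩ := Finset.card_eq_one.1 hcard
  have hv' : ∀ u, u = v ↔ u ∉ A ∧ u ∉ B := by
    intro u
    rw [← Finset.mem_singleton, ← hv]
    simp
  have hvv := (hv' v).1 rfl
  refine ⟨v, A, B, ⟨hAc, hBc, hdis, hvv.1, hvv.2, fun u => ?_, ?_⟩, ?_⟩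
  · have := (hv' u).2
    tauto
  · intro a ha b hb hab
    simp only [hA, hB, Finset.mem_map, Finset.mem_univ, true_and] at ha hb
    obtain ⟨i, rfl⟩ := ha
    obtain ⟨j, rfl⟩ := hb
    rw [SimpleGraph.compl_adj] at hab
    exact hab.2 (f.toHom.map_adj (by simp))
  · intro q hq
    induction q with
    | _ a b =>
      have hmemA : ∀ i, f (Sum.inl i) ∈ A := fun i =>
        Finset.mem_map.2 ⟨i, Finset.mem_univ _, rfl⟩
      have hmemB : ∀ i, f (Sum.inr i) ∈ B := fun i =>
        Finset.mem_map.2 ⟨i, Finset.mem_univ _, rfl⟩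
      obtain ⟨p, r, hpr, rfl, rfl⟩ := hq
      rcases p with p | p <;> rcases r with r | r
      · simp at hpr
      · exact ⟨_, hmemA p, _, hmemB r, rfl⟩
      · exact ⟨_, hmemA r, _, hmemB p, Sym2.eq_swap⟩
      · simp at hpr

theorem IsHingeCut.exists_copy {V : Type*} {s t : ℕ} {J : SimpleGraph V} {v : V} {A B : Finset V}
    (hc : IsHingeCut Jᶜ s t v A B) {x y : V} (hx : x ∈ A) (hy : y ∈ B) :
    ∃ f : SimpleGraph.Copy (completeBipartiteGraph (Fin s) (Fin t)) J,
      s(x, y) ∈ f.toSubgraph.edgeSet := by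
  classical
  let eA := (A.equivFinOfCardEq hc.card_left).symm
  let eB := (B.equivFinOfCardEq hc.card_right).symm
  let g : Fin s ⊕ Fin t → V := Sum.elim (fun i => (eA i : V)) (fun i => (eB i : V))
  have hadj : ∀ a ∈ A, ∀ b ∈ B, J.Adj a b := by
    intro a ha b hb
    have h1 := hc.not_adj a ha b hb
    rw [SimpleGraph.compl_adj] at h1
    by_contra h2
    exact h1 ⟨hc.ne ha hb, h2⟩
  have hg : ∀ p r, (completeBipartiteGraph (Fin s) (Fin t)).Adj p r → J.Adj (g p) (g r) := by
    rintro (p | p) (r | r) h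
    · simp at h
    · exact hadj _ (eA p).2 _ (eB r).2
    · exact (hadj _ (eA r).2 _ (eB p).2).symm
    · simp at h
  have hinj : Function.Injective g := by
    rintro (p | p) (r | r) h
    · exact congrArg _ (eA.injective (Subtype.ext h))
    · exact absurd h (hc.ne (eA p).2 (eB r).2)
    · exact absurd h.symm (hc.ne (eA r).2 (eB p).2)
    · exact congrArg _ (eB.injective (Subtype.ext h))
  refine ⟨⟨⟨g, fun {a b} => hg a b⟩, hinj⟩, ?_⟩
  refine ⟨Sum.inl (eA.symm ⟨x, hx⟩), Sum.inr (eB.symm ⟨y, hy⟩), by simp, ?_, ?_⟩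
  · change ((eA (eA.symm ⟨x, hx⟩) : A) : V) = x
    simp
  · change ((eB (eB.symm ⟨y, hy⟩) : B) : V) = y
    simp

/-- Removing the edges `e i` from the complete graph, last one first, adds them to the complement.
The copy present when `e i` is removed supplies the cut. -/
theorem IsWeaklySaturated.erodible_compl {V : Type*} [Fintype V] {s t : ℕ}
    (hV : Fintype.card V = s + t + 1) {G : SimpleGraph V}
    (h : IsWeaklySaturated (completeBipartiteGraph (Fin s) (Fin t)) G) :
    ∃ k, Erodible s t k Gᶜ := by
  obtain ⟨-, m, e, hbij, hcopy⟩ := h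
  have key : ∀ j ≤ m, Erodible s t j
      (G ⊔ SimpleGraph.fromEdgeSet (e '' {i | i.val < m - j}))ᶜ := by
    intro j
    induction j with
    | zero =>
      intro _
      have h1 : (G ⊔ SimpleGraph.fromEdgeSet (e '' {i | i.val < m - 0}))ᶜ = ⊥ := by
        rw [eq_bot_iff]
        intro a b hab
        rw [SimpleGraph.compl_adj, SimpleGraph.sup_adj, SimpleGraph.fromEdgeSet_adj] at hab
        have h2 : s(a, b) ∈ (⊤ : SimpleGraph V).edgeSet \ G.edgeSet :=
          ⟨hab.1, fun h => hab.2 (Or.inl h)⟩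
        obtain ⟨i, -, hi⟩ := hbij.surjOn h2
        exact hab.2 (Or.inr ⟨⟨i, i.2, hi⟩, hab.1⟩)
      rw [h1]
      exact .bot
    | succ j ih =>
      intro hj
      obtain ⟨i, hi⟩ : ∃ i : Fin m, i.val = m - (j + 1) := ⟨⟨m - (j + 1), by omega⟩, rfl⟩
      obtain ⟨f, hf⟩ := hcopy i
      have hset : Set.Iic i = {i : Fin m | i.val < m - j} := by
        ext r
        simp only [Set.mem_Iic, Set.mem_ofPred_eq, Fin.le_def, hi]
        omega
      obtain ⟨v, A, B, hc, hq⟩ := IsHingeCut.of_copy hV f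
      obtain ⟨x, hx, y, hy, hxy⟩ := hq _ hf
      rw [hset] at hc
      convert (ih (by omega)).step hc hx hy using 1
      have hne := hc.ne hx hy
      have h1 := hbij.mapsTo (Set.mem_univ i)
      have h2 : e '' {i | i.val < m - j} = insert (e i) (e '' {i | i.val < m - (j + 1)}) := by
        rw [← Set.image_insert_eq]
        congr 1
        ext r
        simp only [Set.mem_ofPred_eq, Set.mem_insert_iff, Fin.ext_iff, hi]
        omega
      have h3 : e i ∉ e '' {i | i.val < m - (j + 1)} := by
        rintro ⟨r, hr, hri⟩
        have := hbij.injOn (Set.mem_univ _) (Set.mem_univ _) hri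
        subst this
        simp [hi] at hr
      rw [h2, hxy]
      rw [hxy] at h1 h3
      ext a b
      have h4 : s(a, b) = s(x, y) → ¬ G.Adj a b ∧
          s(a, b) ∉ e '' {i | i.val < m - (j + 1)} := by
        intro h
        rw [h]
        refine ⟨fun h' => h1.2 ?_, h3⟩
        rw [← h]
        exact h'
      rw [SimpleGraph.sup_adj, SimpleGraph.compl_adj, SimpleGraph.compl_adj, SimpleGraph.sup_adj,
        SimpleGraph.sup_adj, SimpleGraph.fromEdgeSet_adj, SimpleGraph.fromEdgeSet_adj,
        SimpleGraph.edge, SimpleGraph.fromEdgeSet_adj, Set.mem_insert_iff, Set.mem_singleton_iff]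
      tauto
  refine ⟨m, ?_⟩
  simpa using key m le_rfl

theorem Erodible.exists_order {V : Type*} {s t k : ℕ} {H : SimpleGraph V}
    (h : Erodible s t k H) :
    ∃ e : Fin k → Sym2 V, Function.Injective e ∧ Set.range e = H.edgeSet ∧
      ∀ i, ∃ v A B, ∃ x ∈ A, ∃ y ∈ B,
        IsHingeCut (Hᶜ ⊔ SimpleGraph.fromEdgeSet (e '' Set.Iic i))ᶜ s t v A B ∧
          e i = s(x, y) := by
  induction h with
  | bot => exact ⟨Fin.elim0, fun i => i.elim0, by simp, fun i => i.elim0⟩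
  | @step k H v A B x y h hc hx hy ih =>
    obtain ⟨e, hinj, hrange, hcut⟩ := ih
    have hE := hc.edgeSet_sup hx hy
    -- The edge added last to `H` is the first one restored to its complement.
    set e' : Fin (k + 1) → Sym2 V := Fin.cons s(x, y) e with he'
    refine ⟨e', ?_, ?_, ?_⟩
    · rw [he', Fin.cons_injective_iff]
      refine ⟨?_, hinj⟩
      rw [hrange]
      exact hc.not_adj x hx y hy
    · rw [he', Fin.range_cons, hrange, hE]
    · have hadj : ∀ a b (S : Set (Sym2 V)), s(x, y) ∈ S →
          ((H ⊔ SimpleGraph.edge x y)ᶜ ⊔ SimpleGraph.fromEdgeSet S)ᶜ.Adj a b →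
            a ≠ b ∧ H.Adj a b ∧ s(a, b) ∉ S := by
        intro a b S hS hab
        rw [SimpleGraph.compl_adj, SimpleGraph.sup_adj, SimpleGraph.compl_adj,
          SimpleGraph.fromEdgeSet_adj] at hab
        have h1 : s(a, b) ∉ S := fun h1 => hab.2 (Or.inr ⟨h1, hab.1⟩)
        refine ⟨hab.1, ?_, h1⟩
        have h2 : (H ⊔ SimpleGraph.edge x y).Adj a b := by
          by_contra h2
          exact hab.2 (Or.inl ⟨hab.1, h2⟩)
        rw [← SimpleGraph.mem_edgeSet, hE] at h2
        rcases h2 with h2 | h2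
        · exact absurd (h2 ▸ hS) h1
        · exact h2
      intro i
      refine Fin.cases ?_ (fun i => ?_) i
      · refine ⟨v, A, B, x, hx, y, hy, hc.mono ?_, rfl⟩
        intro a b hab
        exact (hadj a b (e' '' Set.Iic 0) ⟨0, Set.mem_Iic.2 le_rfl, rfl⟩ hab).2.1
      · obtain ⟨v', A', B', x', hx', y', hy', hc', he⟩ := hcut i
        refine ⟨v', A', B', x', hx', y', hy', hc'.mono ?_, by simpa [he'] using he⟩
        intro a b hab
        obtain ⟨h1, h2, h3⟩ := hadj a b (e' '' Set.Iic i.succ)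
          ⟨0, Set.mem_Iic.2 (Fin.zero_le _), rfl⟩ hab
        rw [SimpleGraph.compl_adj, SimpleGraph.sup_adj, SimpleGraph.compl_adj,
          SimpleGraph.fromEdgeSet_adj]
        refine ⟨h1, ?_⟩
        rintro (h4 | ⟨⟨r, hr, hr'⟩, -⟩)
        · exact h4.2 h2
        · exact h3 ⟨r.succ, Set.mem_Iic.2 (Fin.succ_le_succ_iff.2 hr), by simpa [he'] using hr'⟩

/-- The reversed building order is a saturating order, and the absence of further cuts of `H` is
what makes its complement free of copies. -/
theorem Erodible.isWeaklySaturated_compl {V : Type*} [Fintype V] {s t k : ℕ}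
    (hV : Fintype.card V = s + t + 1) {H : SimpleGraph V} (h : Erodible s t k H)
    (hH : ∀ v A B, ¬ IsHingeCut H s t v A B) :
    IsWeaklySaturated (completeBipartiteGraph (Fin s) (Fin t)) Hᶜ := by
  refine ⟨?_, ?_⟩
  · rintro ⟨f⟩
    obtain ⟨v, A, B, hc, -⟩ := IsHingeCut.of_copy hV f
    rw [compl_compl] at hc
    exact hH v A B hc
  · obtain ⟨e, hinj, hrange, hcut⟩ := h.exists_order
    refine ⟨k, e, ?_, fun i => ?_⟩
    · have h1 : (⊤ : SimpleGraph V).edgeSet \ Hᶜ.edgeSet = H.edgeSet := by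
        ext q
        induction q with
        | _ a b =>
          have : H.Adj a b → a ≠ b := fun h => h.ne
          simp only [Set.mem_sdiff, SimpleGraph.mem_edgeSet, SimpleGraph.top_adj,
            SimpleGraph.compl_adj]
          tauto
      rw [h1, ← hrange, ← Set.image_univ]
      exact hinj.injOn.bijOn_image
    · obtain ⟨v, A, B, x, hx, y, hy, hc, he⟩ := hcut i
      rw [he]
      exact hc.exists_copy hx hy

theorem ncard_edgeSet_add_compl {V : Type*} [Fintype V] (G : SimpleGraph V) :
    G.edgeSet.ncard + Gᶜ.edgeSet.ncard = (Fintype.card V).choose 2 := by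
  classical
  rw [← Set.ncard_union_eq (SimpleGraph.disjoint_edgeSet.2 disjoint_compl_right) (Set.toFinite _)
    (Set.toFinite _), ← SimpleGraph.edgeSet_sup, sup_compl_eq_top,
    ← SimpleGraph.card_edgeFinset_top_eq_card_choose_two (V := V),
    ← SimpleGraph.coe_edgeFinset, Set.ncard_coe_finset]

/-- Any erodible graph bounds the weak saturation number from above. -/
theorem wsat_add_le {s t k : ℕ} (hs : 2 ≤ s) (hst : s < t)
    {H : SimpleGraph (Fin (s + t + 1))} (h : Erodible s t k H) :
    wsat (s + t + 1) (completeBipartiteGraph (Fin s) (Fin t)) + k ≤ (s + t + 1).choose 2 ∧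
      (s + t + 1).choose 2 ≤ wsat (s + t + 1) (completeBipartiteGraph (Fin s) (Fin t)) +
        (2 * s + 2 * t - 2) := by
  have hV : Fintype.card (Fin (s + t + 1)) = s + t + 1 := Fintype.card_fin _
  -- While a cut exists one more edge can be added; the upper bound on `k` stops this growth, and
  -- the final graph has no cut.
  obtain ⟨k', hk', H', h', hH'⟩ : ∃ k' ≥ k, ∃ H' : SimpleGraph (Fin (s + t + 1)),
      Erodible s t k' H' ∧ ∀ v A B, ¬ IsHingeCut H' s t v A B := by
    by_contra! hcon
    have hgrow : ∀ j, ∃ H' : SimpleGraph (Fin (s + t + 1)), Erodible s t (k + j) H' := by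
      intro j
      induction j with
      | zero => exact ⟨H, h⟩
      | succ j ih =>
        obtain ⟨H', h'⟩ := ih
        obtain ⟨v, A, B, hc⟩ := hcon (k + j) (by omega) H' h'
        obtain ⟨x, hx⟩ := Finset.card_pos.1 (by rw [hc.card_left]; omega : 0 < A.card)
        obtain ⟨y, hy⟩ := Finset.card_pos.1 (by rw [hc.card_right]; omega : 0 < B.card)
        exact ⟨_, h'.step hc hx hy⟩
    obtain ⟨H', h'⟩ := hgrow (2 * s + 2 * t)
    have := h'.le hs hst hV
    omega
  have hws := h'.isWeaklySaturated_compl hV hH'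
  have hcount := ncard_edgeSet_add_compl H'
  rw [hV, h'.ncard_edgeSet] at hcount
  have hmem : H'ᶜ.edgeSet.ncard ∈ {k : ℕ | ∃ G : SimpleGraph (Fin (s + t + 1)),
      IsWeaklySaturated (completeBipartiteGraph (Fin s) (Fin t)) G ∧ G.edgeSet.ncard = k} :=
    ⟨_, hws, rfl⟩
  constructor
  · have := Nat.sInf_le hmem
    unfold wsat
    omega
  -- The complement of `H'` shows that the set is nonempty, so the infimum is attained rather than
  -- the default value `0`.
  · obtain ⟨G, hG, hGk⟩ := Nat.sInf_mem ⟨_, hmem⟩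
    obtain ⟨m, hm⟩ := hG.erodible_compl hV
    have h1 := hm.le hs hst hV
    have h2 := ncard_edgeSet_add_compl G
    rw [hV, hm.ncard_edgeSet] at h2
    unfold wsat
    omega

/-! ### Constructions with many edges -/

theorem Erodible.comap {V W : Type*} {s t k : ℕ} {H : SimpleGraph V} (h : Erodible s t k H)
    (φ : W ≃ V) : Erodible s t k (H.comap φ) := by
  induction h with
  | bot =>
    have : (⊥ : SimpleGraph V).comap φ = ⊥ := by ext; simp
    rw [this]
    exact .bot
  | @step k H v A B x y h hc hx hy ih =>
    have h1 : (H ⊔ SimpleGraph.edge x y).comap φ =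
        H.comap φ ⊔ SimpleGraph.edge (φ.symm x) (φ.symm y) := by
      ext a b
      simp [SimpleGraph.edge_adj, Equiv.eq_symm_apply]
    rw [h1]
    refine ih.step (v := φ.symm v) (A := A.map φ.symm.toEmbedding) (B := B.map φ.symm.toEmbedding)
      ⟨by simp [hc.card_left], by simp [hc.card_right], ?_, ?_, ?_, ?_, ?_⟩ ?_ ?_
    · simpa [Finset.mem_map_equiv] using fun u => hc.disj (φ u)
    · simpa using hc.notMem_left
    · simpa using hc.notMem_right
    · intro u
      simpa [Finset.mem_map_equiv, Equiv.eq_symm_apply] using hc.cover (φ u)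
    · intro a ha b hb
      rw [Finset.mem_map_equiv, Equiv.symm_symm] at ha hb
      exact hc.not_adj _ ha _ hb
    · simpa using hx
    · simpa using hy

/-- Some subgraph of `K` arises from the empty graph by adding `k` edges across hinge cuts. -/
def ErodibleWithin {V : Type*} (s t k : ℕ) (K : SimpleGraph V) : Prop :=
  ∃ H ≤ K, Erodible s t k H

theorem ErodibleWithin.mono {V : Type*} {s t k : ℕ} {K K' : SimpleGraph V}
    (h : ErodibleWithin s t k K) (hK : K ≤ K') : ErodibleWithin s t k K' := by
  obtain ⟨H, hH, h⟩ := h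
  exact ⟨H, hH.trans hK, h⟩

/-- A cut of `K` is a cut of every subgraph. Hence `K` may be a convenient overestimate, while `k`
counts only the edges really added. -/
theorem ErodibleWithin.step {V : Type*} {s t k : ℕ} {K K' : SimpleGraph V} {v : V}
    {A B : Finset V} {x y : V} (h : ErodibleWithin s t k K) (hc : IsHingeCut K s t v A B)
    (hx : x ∈ A) (hy : y ∈ B) (hK : K ≤ K') (hxy : K'.Adj x y) :
    ErodibleWithin s t (k + 1) K' := by
  obtain ⟨H, hH, h⟩ := h
  refine ⟨_, sup_le (hH.trans hK) ?_, h.step (hc.mono hH) hx hy⟩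
  rwa [SimpleGraph.edge_le_iff, or_iff_right (hc.ne hx hy)]

section
variable {D Z : Type*}

/-- The relation generating `frame`. -/
def frameRel (p : D → D → Prop) (q : D → Prop) (r : Z → Prop) (w : Z → Z → Prop) :
    Option (D ⊕ Z) → Option (D ⊕ Z) → Prop
  | some (.inl d), some (.inl d') => p d d'
  | some (.inr z), some (.inr z') => w z z'
  | none, some (.inl d) => q d
  | none, some (.inr z) => r z
  | _, _ => False

/-- The graph on `D`, `Z` and an apex `none`, given by relations on `D` and on `Z` and by the
neighbours of the apex, without edges between `D` and `Z`. -/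
def frame (p : D → D → Prop) (q : D → Prop) (r : Z → Prop) (w : Z → Z → Prop) :
    SimpleGraph (Option (D ⊕ Z)) :=
  SimpleGraph.fromRel (frameRel p q r w)

theorem frame_mono {p p' : D → D → Prop} {q q' : D → Prop} {r r' : Z → Prop}
    {w w' : Z → Z → Prop} (hp : ∀ a b, p a b → p' a b) (hq : ∀ a, q a → q' a)
    (hr : ∀ a, r a → r' a) (hw : ∀ a b, w a b → w' a b) :
    frame p q r w ≤ frame p' q' r' w' := by
  have key : ∀ a b, frameRel p q r w a b → frameRel p' q' r' w' a b := by
    rintro (_ | a | a) (_ | b | b) h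
    exacts [h, hq _ h, hr _ h, h, hp _ _ h, h, h, h, hw _ _ h]
  intro a b hab
  rw [frame, SimpleGraph.fromRel_adj] at hab ⊢
  exact ⟨hab.1, hab.2.imp (key _ _) (key _ _)⟩

theorem frame_adj_of_rel {p : D → D → Prop} {q : D → Prop} {r : Z → Prop} {w : Z → Z → Prop}
    {a b : Option (D ⊕ Z)} (hne : a ≠ b) (h : frameRel p q r w a b ∨ frameRel p q r w b a) :
    (frame p q r w).Adj a b := by
  rw [frame, SimpleGraph.fromRel_adj]
  exact ⟨hne, h⟩

variable [Fintype D] [Fintype Z] [DecidableEq Z] {s t : ℕ}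
  {p : D → D → Prop} {q : D → Prop} {r : Z → Prop} {w : Z → Z → Prop}

theorem isHingeCut_right (hD : Fintype.card D = s) (hZ : Fintype.card Z = t) (z₁ : Z)
    (hq : ∀ a, ¬ q a) :
    IsHingeCut (frame p q r w) s t (some (.inr z₁))
      (((Finset.univ : Finset D).disjSum (∅ : Finset Z)).map .some)
      (Finset.insertNone ((∅ : Finset D).disjSum {z₁}ᶜ)) := by
  refine ⟨by simp [hD], ?_, ?_, by simp, by simp, ?_, ?_⟩
  · rw [Finset.card_insertNone, Finset.card_disjSum, Finset.card_compl, hZ]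
    have := Finset.card_le_univ {z₁}
    simp at this ⊢
    omega
  · rintro (_ | a | a) <;> simp
  · rintro (_ | a | a) <;> simp [em]
  · rintro (_ | a | a) ha (_ | b | b) hb <;> simp at ha hb <;>
      simp only [frame, SimpleGraph.fromRel_adj, frameRel, not_and, not_or, not_false_iff,
        implies_true, and_self, true_and]
    exact fun _ => hq a

variable [DecidableEq D]

/-- Edges at the hinge never cross the cut, so `q` and `r` are unrestricted here: edges at the apex
may all be allowed once only these cuts are used. -/
theorem isHingeCut_apex (hD : Fintype.card D = s) (hZ : Fintype.card Z = t) (X : Finset D)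
    (Y : Finset Z) (hXY : X.card + Y.card = s)
    (hp : ∀ a ∈ X, ∀ b ∉ X, ¬ p a b ∧ ¬ p b a) (hw : ∀ a ∈ Y, ∀ b ∉ Y, ¬ w a b ∧ ¬ w b a) :
    IsHingeCut (frame p q r w) s t none ((X.disjSum Y).map .some)
      ((Xᶜ.disjSum Yᶜ).map .some) := by
  refine ⟨by simpa using hXY, ?_, ?_, by simp, by simp, ?_, ?_⟩
  · rw [Finset.card_map, Finset.card_disjSum, Finset.card_compl, Finset.card_compl, hD, hZ]
    have := Finset.card_le_univ X
    have := Finset.card_le_univ Y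
    omega
  · rintro (_ | a | a) <;> simp
  · rintro (_ | a | a) <;> simp [em]
  · rintro (_ | a | a) ha (_ | b | b) hb <;> simp at ha hb <;>
      simp only [frame, SimpleGraph.fromRel_adj, frameRel, not_and, not_or, not_false_iff,
        implies_true, and_self]
    · exact fun _ => hp a ha b hb
    · exact fun _ => hw a ha b hb

theorem isHingeCut_left (hD : Fintype.card D = s) (hZ : Fintype.card Z = t) (d₀ : D)
    (X : Finset D) (Y : Finset Z) (hd : d₀ ∉ X) (hXY : X.card + Y.card = s)
    (hp : ∀ a ∈ X, ∀ b ∉ insert d₀ X, ¬ p a b ∧ ¬ p b a)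
    (hw : ∀ a ∈ Y, ∀ b ∉ Y, ¬ w a b ∧ ¬ w b a) (hq : ∀ a ∈ X, ¬ q a) (hr : ∀ a ∈ Y, ¬ r a) :
    IsHingeCut (frame p q r w) s t (some (.inl d₀)) ((X.disjSum Y).map .some)
      (Finset.insertNone ((insert d₀ X)ᶜ.disjSum Yᶜ)) := by
  refine ⟨by simpa using hXY, ?_, ?_, by simpa using hd, by simp, ?_, ?_⟩
  · rw [Finset.card_insertNone, Finset.card_disjSum, Finset.card_compl, Finset.card_compl,
      Finset.card_insert_of_notMem hd, hD, hZ]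
    have h1 := Finset.card_le_univ (insert d₀ X)
    rw [Finset.card_insert_of_notMem hd] at h1
    have := Finset.card_le_univ Y
    omega
  · rintro (_ | a | a) <;> simp +contextual
  · rintro (_ | a | a)
    · simp
    · simp; tauto
    · simp [em]
  · rintro (_ | a | a) ha (_ | b | b) hb <;> simp at ha hb <;>
      simp only [frame, SimpleGraph.fromRel_adj, frameRel, not_and, not_or, not_false_iff,
        implies_true, and_self, true_and]
    · exact fun _ => hq a ha
    · exact fun _ => hp a ha b (by simpa using hb)
    · exact fun _ => hr a ha
    · exact fun _ => hw a ha b hb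

/-- The part of the construction before edges inside `Z` are added. -/
theorem erodibleWithin_frame_empty (hD : Fintype.card D = s) (hZ : Fintype.card Z = t)
    (hs : 2 ≤ s) (ht : 2 ≤ t) :
    ErodibleWithin s t (2 * s + t - 2)
      (frame (D := D) (Z := Z) (fun _ _ => True) (fun _ => True) (fun _ => True)
        (fun _ _ => False)) := by
  obtain ⟨d₀, d₁, hd⟩ := Fintype.exists_pair_of_one_lt_card (α := D) (by omega)
  obtain ⟨z₀, z₁, hz⟩ := Fintype.exists_pair_of_one_lt_card (α := Z) (by omega)
  -- Joining `d₀` to the rest of `D` gives `s - 1` edges. The vertex still isolated is left out of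
  -- the cut's left side and `z₀` takes its place, keeping the size `s`.
  have star : ∀ S : Finset D, d₀ ∉ S → ErodibleWithin s t S.card
      (frame (D := D) (Z := Z) (fun a b => a = d₀ ∧ b ∈ S)
        (fun _ => False) (fun _ => False) (fun _ _ => False)) := by
    intro S
    induction S using Finset.induction with
    | empty => exact fun _ => ⟨⊥, bot_le, .bot⟩
    | insert d S hdS ih =>
      intro h0
      rw [Finset.mem_insert, not_or] at h0
      rw [Finset.card_insert_of_notMem hdS]
      refine (ih h0.2).step (isHingeCut_apex hD hZ (Finset.univ.erase d) {z₀} ?_ ?_ (by simp))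
        (x := some (.inl d₀)) (y := some (.inl d)) (by simp [h0.1]) (by simp)
        (frame_mono ?_ (fun _ => id) (fun _ => id) (fun _ _ => id))
        (frame_adj_of_rel (by simp [h0.1]) (Or.inl (by simp [frameRel])))
      · rw [Finset.card_erase_of_mem (Finset.mem_univ _), Finset.card_univ, hD]
        simp
        omega
      · intro a _ b hb
        obtain rfl : b = d := by simpa using hb
        exact ⟨fun h => hdS h.2, fun h => h0.1 h.1.symm⟩
      · exact fun a b h => ⟨h.1, Finset.mem_insert_of_mem h.2⟩
  -- With hinge `d₀`, joining `d₁` to the other vertices of `D` gives `s - 2` more edges; `z₀` and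
  -- `z₁` replace the two missing vertices of `D`.
  have fan : ∀ S : Finset D, d₀ ∉ S → d₁ ∉ S → ErodibleWithin s t (s - 1 + S.card)
      (frame (D := D) (Z := Z)
        (fun a b => a = d₀ ∨ b = d₀ ∨ a ∈ insert d₁ S ∧ b ∈ insert d₁ S)
        (fun _ => False) (fun _ => False) (fun _ _ => False)) := by
    intro S
    induction S using Finset.induction with
    | empty =>
      intro _ _
      have h := star (Finset.univ.erase d₀) (by simp)
      rw [Finset.card_erase_of_mem (Finset.mem_univ _), Finset.card_univ, hD] at h
      exact h.mono (frame_mono (fun a b h => Or.inl h.1) (fun _ => id) (fun _ => id)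
        (fun _ _ => id))
    | insert d S hdS ih =>
      intro h0 h1
      rw [Finset.mem_insert, not_or] at h0 h1
      rw [Finset.card_insert_of_notMem hdS, ← add_assoc]
      have hd' : d ∉ insert d₁ S := by simp [hdS, Ne.symm h1.1]
      refine (ih h0.2 h1.2).step (isHingeCut_left hD hZ d₀ ((Finset.univ.erase d₀).erase d)
        {z₀, z₁} (by simp) ?_ ?_ (by simp) (by simp) (by simp))
        (x := some (.inl d₁)) (y := some (.inl d)) (by simp [h1.1, hd.symm])
        (by simp [Ne.symm h0.1])
        (frame_mono ?_ (fun _ => id) (fun _ => id) (fun _ _ => id))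
        (frame_adj_of_rel (by simp [h1.1]) (Or.inl (by simp [frameRel])))
      · rw [Finset.card_erase_of_mem (by simp [Ne.symm h0.1]),
          Finset.card_erase_of_mem (Finset.mem_univ _), Finset.card_univ, hD, Finset.card_pair hz]
        omega
      · intro a ha b hb
        simp at ha hb
        obtain rfl : b = d := by by_contra h; exact hb.1 (hb.2 h)
        have h2 := Ne.symm h0.1
        constructor <;> tauto
      · intro a b h
        simp only [Finset.mem_insert] at h ⊢
        tauto
  -- The apex is joined to all of `Z` except `z₀`. Keeping `z₀` away from the apex lets it sit
  -- opposite the apex in the last cut, `h3`.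
  have leaves : ∀ S : Finset Z, z₀ ∉ S → ErodibleWithin s t (2 * s - 3 + S.card)
      (frame (D := D) (Z := Z) (fun _ _ => True) (fun _ => False) (fun z => z ∈ S)
        (fun _ _ => False)) := by
    intro S
    induction S using Finset.induction with
    | empty =>
      intro _
      have h := fan ((Finset.univ.erase d₀).erase d₁) (by simp) (by simp)
      rw [Finset.card_erase_of_mem (by simp [hd.symm]),
        Finset.card_erase_of_mem (Finset.mem_univ _), Finset.card_univ, hD] at h
      rw [Finset.card_empty, show 2 * s - 3 + 0 = s - 1 + (s - 1 - 1) by omega]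
      exact h.mono (frame_mono (fun _ _ _ => trivial) (fun _ => id) (fun _ h => h.elim)
        (fun _ _ => id))
    | insert z S hzS ih =>
      intro h0
      rw [Finset.mem_insert, not_or] at h0
      rw [Finset.card_insert_of_notMem hzS, ← add_assoc]
      refine (ih h0.2).step (isHingeCut_left hD hZ d₀ (Finset.univ.erase d₀) {z} (by simp) ?_ ?_
        (by simp) (by simp) (by simpa using hzS)) (x := some (.inr z)) (y := none)
        (by simp) (by simp)
        (frame_mono (fun _ _ => id) (fun _ => id) (fun _ => Finset.mem_insert_of_mem)
          (fun _ _ => id))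
        (frame_adj_of_rel (by simp) (Or.inr (by simp [frameRel])))
      · rw [Finset.card_erase_of_mem (Finset.mem_univ _), Finset.card_univ, hD,
          Finset.card_singleton]
        omega
      · intro a _ b hb
        simp at hb
  have h1 := leaves (Finset.univ.erase z₀) (by simp)
  rw [Finset.card_erase_of_mem (Finset.mem_univ _), Finset.card_univ, hZ] at h1
  have h2 : ErodibleWithin s t (2 * s - 3 + (t - 1) + 1)
      (frame (D := D) (Z := Z) (fun _ _ => True) (fun d => d = d₀) (fun z => z ≠ z₀)
        (fun _ _ => False)) := by
    refine h1.step (isHingeCut_right hD hZ z₁ fun _ h => h) (x := some (.inl d₀)) (y := none)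
      (by simp) (by simp) (frame_mono (fun _ _ => id) (fun _ h => h.elim) (by simp)
      (fun _ _ => id)) (frame_adj_of_rel (by simp) (Or.inr (by simp [frameRel])))
  have h3 : ErodibleWithin s t (2 * s - 3 + (t - 1) + 1 + 1)
      (frame (D := D) (Z := Z) (fun _ _ => True) (fun _ => True) (fun _ => True)
        (fun _ _ => False)) := by
    refine h2.step (isHingeCut_left hD hZ d₀ (Finset.univ.erase d₀) {z₀} (by simp) ?_ ?_
        (by simp) (by simp) (by simp)) (x := some (.inl d₁)) (y := none)
        (by simp [hd.symm]) (by simp)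
        (frame_mono (fun _ _ => id) (fun _ _ => trivial) (fun _ _ => trivial) (fun _ _ => id))
        (frame_adj_of_rel (by simp) (Or.inr (by simp [frameRel])))
    · rw [Finset.card_erase_of_mem (Finset.mem_univ _), Finset.card_univ, hD,
        Finset.card_singleton]
      omega
    · intro a _ b hb
      simp at hb
  rwa [show 2 * s - 3 + (t - 1) + 1 + 1 = 2 * s + t - 2 by omega] at h3

/-- Adding an edge inside `Z`. -/
theorem ErodibleWithin.frame_step {k : ℕ} {w' : Z → Z → Prop}
    (h : ErodibleWithin s t k
      (frame (D := D) (fun _ _ => True) (fun _ => True) (fun _ => True) w))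
    (hD : Fintype.card D = s) (hZ : Fintype.card Z = t)
    (Y : Finset Z) (hY : Y.card = s) (hw : ∀ a ∈ Y, ∀ b ∉ Y, ¬ w a b ∧ ¬ w b a) {x y : Z}
    (hx : x ∈ Y) (hy : y ∉ Y) (hww : ∀ a b, w a b → w' a b) (hxy : w' x y) :
    ErodibleWithin s t (k + 1)
      (frame (D := D) (fun _ _ => True) (fun _ => True) (fun _ => True) w') := by
  refine h.step (isHingeCut_apex hD hZ ∅ Y (by simpa using hY) (by simp) hw)
    (x := some (.inr x)) (y := some (.inr y)) (by simpa using hx) (by simpa using hy)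
    (frame_mono (fun _ _ => id) (fun _ => id) (fun _ => id) hww)
    (frame_adj_of_rel ?_ (Or.inl hxy))
  rintro h
  simp only [Option.some.injEq, Sum.inr.injEq] at h
  exact hy (h ▸ hx)

/-- The edge that finally joins `D` and `Z`. -/
theorem ErodibleWithin.frame_last {k : ℕ}
    (h : ErodibleWithin s t k
      (frame (D := D) (Z := Z) (fun _ _ => True) (fun _ => True) (fun _ => True) w))
    (hD : Fintype.card D = s) (hZ : Fintype.card Z = t) (hs : 0 < s) (ht : 0 < t) :
    ∃ H : SimpleGraph (Option (D ⊕ Z)), Erodible s t (k + 1) H := by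
  obtain ⟨d⟩ := Fintype.card_pos_iff.1 (hD ▸ hs)
  obtain ⟨z⟩ := Fintype.card_pos_iff.1 (hZ ▸ ht)
  obtain ⟨H, -, hH⟩ := h.step (K' := ⊤) (isHingeCut_apex hD hZ Finset.univ ∅ (by simpa using hD)
    (by simp) (by simp)) (x := some (.inl d)) (y := some (.inr z)) (by simp) (by simp) le_top
    (by simp)
  exact ⟨H, hH⟩

end

/-! ### Edges inside `Z` -/

section
variable {D : Type*} [Fintype D] [DecidableEq D] {s t k : ℕ}

/-- Cutting the cycle `ZMod t` successively at the multiples of `s`, read backwards. -/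
theorem ErodibleWithin.frame_cycle [NeZero t]
    (h : ErodibleWithin s t k
      (frame (D := D) (Z := ZMod t) (fun _ _ => True) (fun _ => True) (fun _ => True)
        (fun _ _ => False)))
    (hD : Fintype.card D = s) (hs : 1 ≤ s) (hst : s < t) (hg : Nat.gcd s t = 1) :
    ∃ w, ErodibleWithin s t (k + (t - 1))
      (frame (D := D) (Z := ZMod t) (fun _ _ => True) (fun _ => True) (fun _ => True) w) := by
  have : Fact (1 < t) := ⟨by omega⟩
  have hinj : ∀ i < t, ∀ j < t, ((i * s : ℕ) : ZMod t) = ((j * s : ℕ) : ZMod t) → i = j := by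
    intro i hi j hj hij
    rw [ZMod.natCast_eq_natCast_iff] at hij
    have hc : Nat.gcd t s = 1 := by rwa [Nat.gcd_comm]
    exact (Nat.ModEq.cancel_right_of_coprime hc hij).eq_of_lt_of_lt hi hj
  have hval : ((s : ℕ) : ZMod t).val = s := ZMod.val_cast_of_lt hst
  have hpred : ∀ u : ZMod t, u ≠ 0 → (u - 1).val = u.val - 1 := by
    intro u hu
    have h1 : u.val ≠ 0 := fun h => hu ((ZMod.val_eq_zero u).1 h)
    rw [ZMod.val_sub (by rw [ZMod.val_one]; omega), ZMod.val_one]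
  have key : ∀ m ≤ t - 1, ErodibleWithin s t (k + m)
      (frame (D := D) (Z := ZMod t) (fun _ _ => True) (fun _ => True) (fun _ => True)
        -- The edges join `j * s - 1` to `j * s`, for `j` descending from `t - 1` to `1`.
        -- Coprimality makes these multiples distinct; `j = 0` is never used, so the cycle stays
        -- open.
        (fun a b => ∃ j : ℕ, t - m ≤ j ∧ j < t ∧ b = ((j * s : ℕ) : ZMod t) ∧ a = b - 1)) := by
    intro m
    induction m with
    | zero =>
      exact fun _ => h.mono (frame_mono (fun _ _ => id) (fun _ => id) (fun _ => id)
        (fun _ _ h => h.elim))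
    | succ m ih =>
      intro hm
      obtain ⟨i, hi⟩ : ∃ i, t - m = i + 2 := ⟨t - m - 2, by omega⟩
      have hstart : (((i + 1) * s : ℕ) : ZMod t) = ((i * s : ℕ) : ZMod t) + (s : ℕ) := by
        push_cast; ring
      have hs0 : ((s : ℕ) : ZMod t) ≠ 0 := by
        intro h0
        rw [h0, ZMod.val_zero] at hval
        omega
      refine (ih (by omega)).frame_step hD (ZMod.card t)
        -- The arc of length `s` starting at `i * s`. Only the cycle edges with `j = i` and `j = i +
        -- 1` cross it: all edges present have `j ≥ i + 2`, and the new one has `j = i + 1`.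
        (Finset.univ.filter fun x => (x - ((i * s : ℕ) : ZMod t)).val < s) ?_ ?_
        (x := (((i + 1) * s : ℕ) : ZMod t) - 1) (y := (((i + 1) * s : ℕ) : ZMod t)) ?_ ?_ ?_ ?_
      · have h1 : (Finset.univ.filter fun x => (x - ((i * s : ℕ) : ZMod t)).val < s) =
            (Finset.range s).image fun n : ℕ => (n : ZMod t) + ((i * s : ℕ) : ZMod t) := by
          ext x
          simp only [Finset.mem_filter, Finset.mem_univ, true_and, Finset.mem_image,
            Finset.mem_range]
          constructor
          · intro h
            exact ⟨_, h, by rw [ZMod.natCast_zmod_val]; ring⟩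
          · rintro ⟨n, hn, rfl⟩
            rw [add_sub_cancel_right, ZMod.val_cast_of_lt (by omega)]
            exact hn
        rw [h1, Finset.card_image_of_injOn, Finset.card_range]
        intro a ha b hb hab
        simp only [Finset.coe_range, Set.mem_Iio] at ha hb
        have h2 := congrArg ZMod.val (add_right_cancel hab)
        rwa [ZMod.val_cast_of_lt (by omega), ZMod.val_cast_of_lt (by omega)] at h2
      · have cross : ∀ a b : ZMod t, (∃ j : ℕ, t - m ≤ j ∧ j < t ∧ b = ((j * s : ℕ) : ZMod t) ∧
            a = b - 1) → ((a - ((i * s : ℕ) : ZMod t)).val < s ↔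
              (b - ((i * s : ℕ) : ZMod t)).val < s) := by
          rintro a b ⟨j, hj, hjt, rfl, rfl⟩
          have h1 : ((j * s : ℕ) : ZMod t) - ((i * s : ℕ) : ZMod t) ≠ 0 := by
            intro h
            have := hinj j hjt i (by omega) (sub_eq_zero.1 h)
            omega
          have h2 : (((j * s : ℕ) : ZMod t) - ((i * s : ℕ) : ZMod t)).val ≠ s := by
            intro h
            have h3 : ((j * s : ℕ) : ZMod t) - ((i * s : ℕ) : ZMod t) = (s : ℕ) :=
              ZMod.val_injective t (h.trans hval.symm)
            have := hinj j hjt (i + 1) (by omega)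
              (by rw [hstart, ← h3]; ring)
            omega
          rw [sub_right_comm, hpred _ h1]
          omega
        intro a ha b hb
        simp only [Finset.mem_filter, Finset.mem_univ, true_and] at ha hb
        exact ⟨fun h => hb ((cross a b h).1 ha), fun h => hb ((cross b a h).2 ha)⟩
      · simp only [Finset.mem_filter, Finset.mem_univ, true_and]
        rw [hstart, show ((i * s : ℕ) : ZMod t) + (s : ℕ) - 1 - ((i * s : ℕ) : ZMod t) =
          (s : ℕ) - 1 by ring, hpred _ hs0, hval]
        omega
      · simp only [Finset.mem_filter, Finset.mem_univ, true_and]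
        rw [hstart, add_sub_cancel_left, hval]
        omega
      · rintro a b ⟨j, hj, h⟩
        exact ⟨j, by omega, h⟩
      · exact ⟨i + 1, by omega, by omega, rfl, rfl⟩
  exact ⟨_, key (t - 1) le_rfl⟩

/-- Without a coprimality assumption, all but two items of `Z` can be joined. -/
theorem ErodibleWithin.frame_loose {Z : Type*} [Fintype Z] [DecidableEq Z]
    (h : ErodibleWithin s t k
      (frame (D := D) (Z := Z) (fun _ _ => True) (fun _ => True) (fun _ => True)
        (fun _ _ => False)))
    (hD : Fintype.card D = s) (hZ : Fintype.card Z = t) (hs : 1 ≤ s) (hst : s + 2 ≤ t) :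
    ∃ w, ErodibleWithin s t (k + (t - 2))
      (frame (D := D) (Z := Z) (fun _ _ => True) (fun _ => True) (fun _ => True) w) := by
  -- `Z` is divided into `I` of size `s`, a spare vertex `l` and the nonempty rest `R`. Stars on `R`
  -- and `I` and one edge between them give `(t - s - 2) + (s - 1) + 1 = t - 2` edges, with `l` left
  -- unjoined.
  obtain ⟨I, -, hI⟩ := Finset.exists_subset_card_eq (s := (Finset.univ : Finset Z)) (n := s)
    (by rw [Finset.card_univ, hZ]; omega)
  obtain ⟨i₀, hi₀⟩ := Finset.card_pos.1 (by omega : 0 < I.card)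
  obtain ⟨l, hl⟩ := Finset.card_pos.1
    (by rw [Finset.card_compl, hZ, hI]; omega : 0 < Iᶜ.card)
  rw [Finset.mem_compl] at hl
  have hRc : (insert l I)ᶜ.card = t - s - 1 := by
    rw [Finset.card_compl, Finset.card_insert_of_notMem hl, hZ, hI]
    omega
  obtain ⟨r₀, hr₀⟩ := Finset.card_pos.1 (by omega : 0 < (insert l I)ᶜ.card)
  have hR : ∀ u ∈ (insert l I)ᶜ, u ≠ l ∧ u ∉ I := by
    intro u hu
    simpa using hu
  generalize (insert l I)ᶜ = R at *
  have joinR : ∀ S ⊆ R, r₀ ∉ S → ErodibleWithin s t (k + S.card)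
      (frame (D := D) (Z := Z) (fun _ _ => True) (fun _ => True) (fun _ => True)
        (fun a b => a ∈ S ∧ b = r₀)) := by
    intro S
    induction S using Finset.induction with
    | empty =>
      exact fun _ _ => h.mono (frame_mono (fun _ _ => id) (fun _ => id) (fun _ => id)
        (fun _ _ h => h.elim))
    | insert r S hrS ih =>
      intro hSR h0
      rw [Finset.insert_subset_iff] at hSR
      rw [Finset.mem_insert, not_or] at h0
      rw [Finset.card_insert_of_notMem hrS, ← add_assoc]
      have hrI := (hR r hSR.1).2
      have hr₀I := (hR r₀ hr₀).2
      refine (ih hSR.2 h0.2).frame_step hD hZ (insert r (I.erase i₀)) ?_ ?_ (x := r) (y := r₀)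
        (by simp) ?_ (fun a b h => ⟨Finset.mem_insert_of_mem h.1, h.2⟩) (by simp)
      · rw [Finset.card_insert_of_notMem fun h => hrI (Finset.mem_of_mem_erase h),
          Finset.card_erase_of_mem hi₀, hI]
        omega
      · intro a ha b _
        rcases Finset.mem_insert.1 ha with rfl | ha
        · exact ⟨fun h => hrS h.1, fun h => h0.1 h.2.symm⟩
        · have haI := Finset.mem_of_mem_erase ha
          exact ⟨fun h => (hR a (hSR.2 h.1)).2 haI, fun h => hr₀I (h.2 ▸ haI)⟩
      · rw [Finset.mem_insert, not_or]
        exact ⟨h0.1, fun h => hr₀I (Finset.mem_of_mem_erase h)⟩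
  have joinI : ∀ S ⊆ I, i₀ ∉ S → ErodibleWithin s t (k + (t - s - 2) + S.card)
      (frame (D := D) (Z := Z) (fun _ _ => True) (fun _ => True) (fun _ => True)
        (fun a b => a ∈ R ∧ b ∈ R ∨ a = i₀ ∧ b ∈ S)) := by
    intro S
    induction S using Finset.induction with
    | empty =>
      intro _ _
      have h1 := joinR (R.erase r₀) (Finset.erase_subset _ _) (by simp)
      rw [Finset.card_erase_of_mem hr₀, hRc, Nat.sub_sub _ 1 1] at h1
      exact h1.mono (frame_mono (fun _ _ => id) (fun _ => id) (fun _ => id)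
        (fun _ _ h => Or.inl ⟨Finset.mem_of_mem_erase h.1, h.2 ▸ hr₀⟩))
    | insert i S hiS ih =>
      intro hSI h0
      rw [Finset.insert_subset_iff] at hSI
      rw [Finset.mem_insert, not_or] at h0
      rw [Finset.card_insert_of_notMem hiS, ← add_assoc]
      have hli : l ≠ i := fun h => hl (h ▸ hSI.1)
      -- The spare vertex `l` replaces `i`, so that the cut separates `i` from the rest of `I` and
      -- still has `s` vertices.
      refine (ih hSI.2 h0.2).frame_step hD hZ (insert l (I.erase i)) ?_ ?_ (x := i₀) (y := i)
        ?_ ?_ ?_ (by simp)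
      · rw [Finset.card_insert_of_notMem fun h => hl (Finset.mem_of_mem_erase h),
          Finset.card_erase_of_mem hSI.1, hI]
        omega
      · intro a ha b hb
        have haR : a ∉ R := by
          intro h
          rcases Finset.mem_insert.1 ha with rfl | ha
          · exact (hR _ h).1 rfl
          · exact (hR _ h).2 (Finset.mem_of_mem_erase ha)
        have hbI : b ∈ I → b = i := by
          intro h
          by_contra h1
          exact hb (Finset.mem_insert_of_mem (Finset.mem_erase.2 ⟨h1, h⟩))
        refine ⟨?_, ?_⟩
        · rintro (h | h)
          · exact haR h.1
          · exact hiS (hbI (hSI.2 h.2) ▸ h.2)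
        · rintro (h | h)
          · exact haR h.2
          · exact h0.1 (h.1.symm.trans (hbI (h.1 ▸ hi₀)))
      · exact Finset.mem_insert_of_mem (Finset.mem_erase.2 ⟨h0.1, hi₀⟩)
      · simp [hli.symm]
      · exact fun a b h => h.imp_right fun h => ⟨h.1, Finset.mem_insert_of_mem h.2⟩
  have h1 := joinI (I.erase i₀) (Finset.erase_subset _ _) (by simp)
  rw [Finset.card_erase_of_mem hi₀, hI] at h1
  have h2 := h1.frame_step (w' := fun _ _ => True) hD hZ I hI ?_ hi₀ (hR r₀ hr₀).2
    (fun _ _ _ => trivial) trivial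
  · rw [show k + (t - s - 2) + (s - 1) + 1 = k + (t - 2) by omega] at h2
    exact ⟨_, h2⟩
  · intro a ha b hb
    refine ⟨?_, ?_⟩
    · rintro (h | h)
      · exact (hR a h.1).2 ha
      · exact hb (Finset.mem_of_mem_erase h.2)
    · rintro (h | h)
      · exact (hR a h.2).2 ha
      · exact hb (h.1 ▸ hi₀)

end

/-! ### The theorem -/

theorem theorem2 (s t : ℕ) (hs : 2 < s) (hst : s < t) :
    (Nat.gcd s t = 1 →
      (wsat (s + t + 1) (completeBipartiteGraph (Fin s) (Fin t)) : ℤ) =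
        ((s + t + 1).choose 2 : ℤ) - (2 * (s : ℤ) + 2 * (t : ℤ) - 2)) ∧
    (Nat.gcd s t ≠ 1 →
      2 * (s : ℤ) + 2 * (t : ℤ) - 3 ≤
          ((s + t + 1).choose 2 : ℤ) -
            (wsat (s + t + 1) (completeBipartiteGraph (Fin s) (Fin t)) : ℤ) ∧
        ((s + t + 1).choose 2 : ℤ) -
            (wsat (s + t + 1) (completeBipartiteGraph (Fin s) (Fin t)) : ℤ) ≤
          2 * (s : ℤ) + 2 * (t : ℤ) - 2) := by
  have transfer : ∀ {Z : Type} [Fintype Z] {k : ℕ}, Fintype.card Z = t →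
      (∃ H : SimpleGraph (Option (Fin s ⊕ Z)), Erodible s t k H) →
        ∃ H : SimpleGraph (Fin (s + t + 1)), Erodible s t k H := by
    rintro Z _ k hZ ⟨H, hH⟩
    exact ⟨_, hH.comap (Fintype.equivFinOfCardEq (by simp [hZ])).symm⟩
  have hD : Fintype.card (Fin s) = s := Fintype.card_fin s
  constructor
  · intro hg
    have : NeZero t := ⟨by omega⟩
    have hZ := ZMod.card t
    obtain ⟨w, hw⟩ := (erodibleWithin_frame_empty hD hZ (by omega) (by omega)).frame_cycle hD
      (by omega) hst hg
    obtain ⟨H, hH⟩ := transfer hZ (hw.frame_last hD hZ (by omega) (by omega))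
    have := wsat_add_le (by omega) hst hH
    omega
  · intro hg
    -- Consecutive integers are coprime, so `t = s + 1` is excluded; this leaves room for the spare
    -- vertex and a nonempty rest.
    have hst' : s + 2 ≤ t := by
      by_contra! hcon
      obtain rfl : t = s + 1 := by omega
      simp at hg
    have hZ := Fintype.card_fin t
    obtain ⟨w, hw⟩ := (erodibleWithin_frame_empty hD hZ (by omega) (by omega)).frame_loose hD hZ
      (by omega) hst'
    obtain ⟨H, hH⟩ := transfer hZ (hw.frame_last hD hZ (by omega) (by omega))
    have := wsat_add_le (by omega) hst hH
    omega
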